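/- **Theorem 3 (Upper bound in the heterogeneous setting).** *Problem.* Let $f_1,\dots,f_n:\mathbb R^d\to\mathbb R$ be differentiable, $f=\frac1n\sum_{i=1}^n f_i$, and let $f$ be $L$-smooth ($\|\nabla f(x)-\nabla f(y)\|\le L\|x-y\|$ for all $x,y$, $L>0$) and bounded from below by $f^*\in\mathbb R$; put $\Delta=f(x^0)-f^*$, where $x^0$ is the starting point. Worker $i\in[n]$ can only compute stochastic gradients $\nabla f_i(x;\xi)$, $\xi\sim\mathcal D_i$, with $\mathbb E[\nabla f_i(x;\xi)]=\nabla f_i(x)$ and $\mathbb E\|\nabla f_i(x;\xi)-\nabla f_i(x)\|^2\le\sigma^2$ for all $x$; all samples are independent. Let $\varepsilon>0$. *Time model.* Worker $i$ needs $h_i>0$ seconds for one stochastic gradient. The workers are the vertices of a connected graph $G$ with symmetric bandwidths $b_{ij}=b_{ji}>0$ on its links: worker $i$ can send $b_{ij}$ coordinates per second to worker $j$, in both directions and over all links simultaneously. Data are divisible and links have no latency, i.e., sending $s$ coordinates ($s>0$ real) takes exactly $s/b_{ij}$ seconds. Workers may forward data and add up partial sums of data in the network; all operations other than computing stochastic gradients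 and sending data take no time. *Leon SGD.* In iteration $k=0,1,\dots$ every worker $i$ computes stochastic gradients $\nabla f_i(x^k;\xi^k_{ij})$, one after another, until, for the first time, the numbers $B_i\ge 1$ of computed gradients satisfy $\big(\frac1n\sum_{i=1}^n\frac1{B_i}\big)^{-1}\ge\max\{\lceil\sigma^2/\varepsilon\rceil,n\}/n$; then an AllReduce operation over $G$ delivers $\frac1n\sum_{i=1}^n\frac1{B_i}\sum_{j=1}^{B_i}\nabla f_i(x^k;\xi^k_{ij})$ to all workers, and every worker sets $$x^{k+1}=x^k-\frac{1}{2L}\cdot\frac1n\sum_{i=1}^n\frac1{B_i}\sum_{j=1}^{B_i}\nabla f_i(x^k;\xi^k_{ij}).$$ *Claim.* There are universal constants $c,C>0$ and a function $K:\mathbb R\to\mathbb N$ with $K(r)\le C r$ for all $r\ge0$ and $K(r)\ge c\,r$ for all $r\ge1$ (so $K(r)=\Theta(r)$) such that the following holds in every setting as above. For a suitable implementation of AllReduce that depends only on $G$ and $d$, after $K=K(L\Delta/\varepsilon)=\Theta(L\Delta/\varepsilon)$ iterations Leon SGD has found an $\varepsilon$-stationary point: $\frac1{K+1}\sum_{k=0}^{K}\mathbb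 E\|\nabla f(x^k)\|^2\le\varepsilon$, i.e., an iterate chosen uniformly at random among $x^0,\dots,x^K$ is an $\varepsilon$-stationary point, and hence $\mathbb E\|\nabla f(x^k)\|^2\le\varepsilon$ also for some fixed $k\le K$. The total time of these $K$ iterations is at most $$C\,\max\Big\{\frac{d}{\bar w_1},\ \max_{i\in[n]}h_i,\ \frac{\sigma^2}{n\varepsilon}\Big(\frac1n\sum_{i=1}^n h_i\Big)\Big\}\frac{L\Delta}{\varepsilon}$$ seconds, where $\bar w_1$ is the global minimum cut value of $G$, i.e., the minimum of $\sum_{i\in U,\,j\notin U}b_{ij}$ over all $\emptyset\ne U\subsetneq[n]$ ($\bar w_1=\infty$ if $n=1$). Equivalently, $\bar w_1$ is the minimum edge weight of any Gomory–Hu tree of $G$. -/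

import Mathlib

open MeasureTheory ProbabilityTheory
open scoped ENNReal

noncomputable section

/-! ### The communication graph, cuts, and Gomory–Hu trees -/

/-- A connected graph on the `n` workers with symmetric bandwidths: `bw i j` is the number of
coordinates per second that worker `i` can send to worker `j`.  The directed link `(i, j)` exists
iff `i ≠ j` and `bw i j > 0`, and then so does `(j, i)`, with the same bandwidth. -/
structure BandwidthGraph (n : ℕ) where
  bw : Fin n → Fin n → ℝ
  bw_nonneg : ∀ i j, 0 ≤ bw i j
  bw_symm : ∀ i j, bw i j = bw j i
  connected : (SimpleGraph.fromRel fun i j => 0 < bw i j).Connected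

namespace BandwidthGraph

variable {n : ℕ}

/-- The set of links. -/
def toSimpleGraph (G : BandwidthGraph n) : SimpleGraph (Fin n) :=
  SimpleGraph.fromRel fun i j => 0 < G.bw i j

/-- The value of the cut `(U, V \ U)`; every undirected edge of the cut is counted once. -/
def cutValue (G : BandwidthGraph n) (U : Finset (Fin n)) : ℝ :=
  ∑ i ∈ U, ∑ j ∈ Uᶜ, G.bw i j

/-- The global minimum cut value; it is `∞` if there is only one worker (no cut exists). -/
def minCut (G : BandwidthGraph n) : ℝ≥0∞ :=
  ⨅ (U : Finset (Fin n)) (_ : U.Nonempty) (_ : U ≠ Finset.univ), ENNReal.ofReal (G.cutValue U)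

open Classical in
/-- The component that contains `i` after the edge `{i, j}` is removed from `T`. -/
def treeSide (T : SimpleGraph (Fin n)) (i j : Fin n) : Finset (Fin n) :=
  Finset.univ.filter fun v => (T.deleteEdges {s(i, j)}).Reachable i v

/-- `(T, w)` is a Gomory–Hu tree of (the undirected version of) `G`: `T` is a tree on the workers,
and for every edge `{i, j}` of `T` the cut induced by a component of `T - {i, j}` is a minimum
`i`–`j` cut, of value `w {i, j}`. -/
structure IsGomoryHuTree (G : BandwidthGraph n) (T : SimpleGraph (Fin n))
    (w : Sym2 (Fin n) → ℝ) : Prop where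
  isTree : T.IsTree
  weight : ∀ i j, T.Adj i j → w s(i, j) = G.cutValue (treeSide T i j)
  minimum : ∀ i j, T.Adj i j → ∀ U : Finset (Fin n), i ∈ U → j ∉ U →
    G.cutValue (treeSide T i j) ≤ G.cutValue U

end BandwidthGraph

/-! ### Communication: packets, in-network aggregation, AllReduce

Every worker `i` holds a vector `a i` of `d` coordinates, viewed as a stream of data that occupies
the interval `[0, d)`: coordinate `c` is the part `[c, c + 1)`.  Data are divisible and links have
no latency, so that sending the part `[lo, hi)` over a link of bandwidth `b` takes exactly
`(hi - lo) / b` seconds. -/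

/-- One transmission: `src` sends to `dst`, from time `start` on, the part `[lo, hi)` of the partial
sum `∑ i ∈ agg, a i`. -/
structure Packet (n : ℕ) where
  src : Fin n
  dst : Fin n
  lo : ℝ
  hi : ℝ
  start : ℝ
  agg : Finset (Fin n)

/-- The time at which a packet has arrived completely. -/
def Packet.finish {n : ℕ} (G : BandwidthGraph n) (p : Packet n) : ℝ :=
  p.start + (p.hi - p.lo) / G.bw p.src p.dst

/-- `Holds G S t v u A`: given the transmissions `S`, at time `t` worker `v` holds the partial sum
`∑ i ∈ A, a i` at position `u` of the stream.  A worker holds its own data and what it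
has completely received, and it adds partial sums with disjoint sets of contributors in no time. -/
inductive Holds {n : ℕ} (G : BandwidthGraph n) (S : Set (Packet n)) (t : ℝ) (v : Fin n) (u : ℝ) :
    Finset (Fin n) → Prop where
  | own : Holds G S t v u {v}
  | recv (p : Packet n) (hp : p ∈ S) (hdst : p.dst = v) (hfin : p.finish G ≤ t)
      (hlo : p.lo ≤ u) (hhi : u < p.hi) : Holds G S t v u p.agg
  | add {A B : Finset (Fin n)} (hA : Holds G S t v u A) (hB : Holds G S t v u B)
      (hAB : Disjoint A B) : Holds G S t v u (A ∪ B)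

/-- The transmissions `S` implement an AllReduce of vectors with `d` coordinates over `G` within `T`
seconds: there are finitely many packets, each uses a link of `G` and carries a partial sum that its
sender holds when it starts sending; packets on the same directed link do not overlap in time; and
at time `T` every worker holds the sum over all workers, at every position. -/
structure IsAllReduce {n : ℕ} (G : BandwidthGraph n) (d : ℕ) (S : Set (Packet n)) (T : ℝ) :
    Prop where
  time_nonneg : 0 ≤ T
  finite : S.Finite
  link : ∀ p ∈ S, G.toSimpleGraph.Adj p.src p.dst
  part : ∀ p ∈ S, 0 ≤ p.lo ∧ p.lo < p.hi ∧ p.hi ≤ d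
  within : ∀ p ∈ S, 0 ≤ p.start ∧ p.finish G ≤ T
  causal : ∀ p ∈ S, ∀ u, p.lo ≤ u → u < p.hi → Holds G S p.start p.src u p.agg
  bandwidth : ∀ p ∈ S, ∀ q ∈ S, p ≠ q → p.src = q.src → p.dst = q.dst →
    p.finish G ≤ q.start ∨ q.finish G ≤ p.start
  complete : ∀ v : Fin n, ∀ u : ℝ, 0 ≤ u → u < d → Holds G S T v u Finset.univ

/-! ### Computation: collecting the batches -/

/-- The number of stochastic gradients that worker `i` has computed `t` seconds after the beginning
of an iteration; one of them takes `h i` seconds. -/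
def batchSize {n : ℕ} (h : Fin n → ℝ) (t : ℝ) (i : Fin n) : ℕ := ⌊t / h i⌋₊

/-- The stopping condition of the collection phase for `ρ = σ² / ε`, for the local batch sizes `B`:
`(1/n ∑ 1 / B i)⁻¹ ≥ max {⌈ρ⌉, n} / n`, where no batch is empty. -/
def BatchesSuffice {n : ℕ} (ρ : ℝ) (B : Fin n → ℕ) : Prop :=
  (∀ i, 1 ≤ B i) ∧
    max (⌈ρ⌉₊ : ℝ) (n : ℝ) / n ≤ ((1 / (n : ℝ)) * ∑ i, 1 / (B i : ℝ))⁻¹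

/-- The collection phase of an iteration takes `τ` seconds: `τ` is the first time at which the
batches computed so far satisfy the stopping condition. -/
def IsCollectTime {n : ℕ} (h : Fin n → ℝ) (ρ τ : ℝ) : Prop :=
  IsLeast {t : ℝ | 0 ≤ t ∧ BatchesSuffice ρ (batchSize h t)} τ

/-! ### The optimization problem, its stochastic oracles, and Leon SGD -/

/-- The points `ℝ^d`, with the Euclidean norm. -/
abbrev Pt (d : ℕ) : Type := EuclideanSpace ℝ (Fin d)

/-- The average of the local functions. -/
def meanObjective {n d : ℕ} (f : Fin n → Pt d → ℝ) (x : Pt d) : ℝ := (1 / (n : ℝ)) * ∑ i, f i x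

/-- `φ` is differentiable with an `L`-Lipschitz gradient. -/
def IsSmooth {d : ℕ} (L : ℝ) (φ : Pt d → ℝ) : Prop :=
  Differentiable ℝ φ ∧ ∀ x y, ‖gradient φ x - gradient φ y‖ ≤ L * ‖x - y‖

/-- `g x ξ` with `ξ ∼ D` is an unbiased stochastic gradient of the differentiable function `φ` at
every point `x`, with variance at most `σ²`. -/
structure IsStochasticGradient {d : ℕ} {Ξ : Type*} [MeasurableSpace Ξ] (D : Measure Ξ)
    (φ : Pt d → ℝ) (σ : ℝ) (g : Pt d → Ξ → Pt d) : Prop where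
  differentiable : Differentiable ℝ φ
  measurable : Measurable (Function.uncurry g)
  integrable : ∀ x, Integrable (g x) D
  unbiased : ∀ x, ∫ ξ, g x ξ ∂D = gradient φ x
  sq_integrable : ∀ x, Integrable (fun ξ => ‖g x ξ - gradient φ x‖ ^ 2) D
  variance_le : ∀ x, ∫ ξ, ‖g x ξ - gradient φ x‖ ^ 2 ∂D ≤ σ ^ 2

/-- The samples `ξ k i j` (iteration `k`, worker `i`, index `j` in its batch) are mutually
independent, and those of worker `i` have distribution `D i`. -/
structure IsSampling {n : ℕ} {Ω Ξ : Type*} [MeasurableSpace Ω] [MeasurableSpace Ξ] (P : Measure Ω)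
    (D : Fin n → Measure Ξ) (ξ : ℕ → Fin n → ℕ → Ω → Ξ) : Prop where
  measurable : ∀ k i j, Measurable (ξ k i j)
  law : ∀ k i j, P.map (ξ k i j) = D i
  indep : iIndepFun (fun q : ℕ × Fin n × ℕ => ξ q.1 q.2.1 q.2.2) P

/-- The iterates of Leon SGD with step size `1 / (2 L)`, local batch sizes `B`, stochastic gradients
`g i` and samples `ξ`, started at `x₀`. -/
def leonIterate {n d : ℕ} {Ω Ξ : Type*} (L : ℝ) (B : Fin n → ℕ) (g : Fin n → Pt d → Ξ → Pt d)
    (x₀ : Pt d) (ξ : ℕ → Fin n → ℕ → Ω → Ξ) : ℕ → Ω → Pt d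
  | 0 => fun _ => x₀
  | k + 1 => fun ω =>
      let x := leonIterate L B g x₀ ξ k ω
      x - ((1 / (2 * L)) / (n : ℝ)) •
        ∑ i, (1 / (B i : ℝ)) • ∑ j ∈ Finset.range (B i), g i x (ξ k i j ω)

/-- The time at which `k` iterations of Leon SGD have been completed, if in every iteration the
batches are collected in `τ` seconds and then aggregated by an AllReduce of `T` seconds; all other
operations take no time. -/
def leonClock (τ T : ℝ) : ℕ → ℝ
  | 0 => 0
  | k + 1 => leonClock τ T k + τ + T

/-- The random point `X` is an `ε`-stationary point of `φ`: `E ‖∇φ(X)‖² ≤ ε`. -/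
def IsEpsStationary {d : ℕ} {Ω : Type*} [MeasurableSpace Ω] (P : Measure Ω) (φ : Pt d → ℝ) (ε : ℝ)
    (X : Ω → Pt d) : Prop :=
  Measurable X ∧ Integrable (fun ω => ‖gradient φ (X ω)‖ ^ 2) P ∧
    ∫ ω, ‖gradient φ (X ω)‖ ^ 2 ∂P ≤ ε

/-- The bound `max {d / w̄₁, maxᵢ hᵢ, (σ² / (n ε)) (1/n ∑ hᵢ)}` on the duration of an iteration,
where `w̄₁` is the global minimum cut value. -/
def iterationBound {n : ℕ} (G : BandwidthGraph n) (d : ℕ) (h : Fin n → ℝ) (σ ε : ℝ) : ℝ :=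
  max ((d : ℝ≥0∞) / G.minCut).toReal
    (max (⨆ i, h i) (σ ^ 2 / (n * ε) * ((1 / (n : ℝ)) * ∑ i, h i)))

end

/-! An iteration costs a collection phase plus an AllReduce, and the number of iterations comes from
the usual analysis of SGD; the three estimates are independent of each other. Collection: once every
worker has a gradient, rounding down loses at most a factor 2, so after `t` seconds the harmonic
mean of the batches is at least `t / (2H)`, with `H` the mean of `h`. Hence 4 times the larger of
the two computation terms suffices (`exists_isCollectTime_le`). Communication: a graph with minimum
cut `w` has a fractional packing of spanning trees of value `w / 2`, a fractional Nash-Williams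
theorem. By separation of convex sets this reduces to finding, for each nonnegative link cost, one
cheap connected spanning set of links; a Kruskal-type contraction does so, because every class of a
partition has a cut of at least `w` (`exists_connects_mul_sum_le`, `exists_connects_packing`). Each
tree gets a share of the data proportional to its weight. Sums travel to the root and back in a
pipeline of `n` blocks: `4n` rounds of length `2(d/n)/w`, or `8d/w` in total
(`TreePacking.isAllReduce`). Convergence: the stopping condition is exactly what bounds the variance
of the averaged gradient by `ε` (`sq_mul_sum_inv_le`). With step `1/(2L)` the descent lemma gives an
expected decrease of `3/(8L) ‖∇f‖² - ε/(8L)` per iteration. Telescoping over `K + 1 > 4LΔ/ε`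
iterates makes the average squared gradient norm at most `ε` (`leonIterate_convergence`). -/

/-! ### Duration of the collection phase -/

section Collect

/-- Batch sizes are right-continuous step functions of time: nothing changes before the next
gradient is completed. This is what makes the first suitable time a minimum and not only an infimum.
-/
theorem exists_forall_batchSize_eq {n : ℕ} (h : Fin n → ℝ) (hpos : ∀ i, 0 < h i) {t : ℝ}
    (ht : 0 ≤ t) : ∃ δ > 0, ∀ s, t ≤ s → s < t + δ → batchSize h s = batchSize h t := by
  have key : ∀ i, ∃ δ > 0, ∀ s, t ≤ s → s < t + δ → batchSize h s i = batchSize h t i := by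
    intro i
    have hi := hpos i
    refine ⟨(⌊t / h i⌋₊ + 1) * h i - t, ?_, ?_⟩
    · have := Nat.lt_floor_add_one (t / h i)
      rw [div_lt_iff₀ hi] at this
      linarith
    · intro s hts hs
      unfold batchSize
      rw [Nat.floor_eq_iff (by have := ht.trans hts; positivity)]
      constructor
      · exact (Nat.floor_le (by positivity)).trans (by gcongr)
      · rw [div_lt_iff₀ hi]; linarith
  choose δ hδ hs using key
  rcases isEmpty_or_nonempty (Fin n) with hn | hn
  · exact ⟨1, one_pos, fun s _ _ => Subsingleton.elim _ _⟩
  · refine ⟨Finset.univ.inf' Finset.univ_nonempty δ, by simpa using hδ, fun s h1 h2 => ?_⟩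
    funext i
    exact hs i s h1 (h2.trans_le (by gcongr; exact Finset.inf'_le _ (Finset.mem_univ i)))

theorem exists_isCollectTime {n : ℕ} (h : Fin n → ℝ) (hpos : ∀ i, 0 < h i) {ρ t : ℝ} (ht : 0 ≤ t)
    (hB : BatchesSuffice ρ (batchSize h t)) : ∃ τ, IsCollectTime h ρ τ ∧ τ ≤ t := by
  set A := {t : ℝ | 0 ≤ t ∧ BatchesSuffice ρ (batchSize h t)} with hA
  have hne : A.Nonempty := ⟨t, ht, hB⟩
  have hbdd : BddBelow A := ⟨0, fun s hs => hs.1⟩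
  have h0 : 0 ≤ sInf A := le_csInf hne fun s hs => hs.1
  obtain ⟨δ, hδ, hconst⟩ := exists_forall_batchSize_eq h hpos h0
  obtain ⟨s, hs, hlt⟩ := exists_lt_of_csInf_lt hne (lt_add_of_pos_right (sInf A) hδ)
  refine ⟨sInf A, ⟨⟨h0, ?_⟩, fun s hs => csInf_le hbdd hs⟩, csInf_le hbdd ⟨ht, hB⟩⟩
  rw [← hconst s (csInf_le hbdd hs) hlt]
  exact hs.2

/-- From `⌊x⌋ ≥ x / 2` for `x ≥ 1`, each `1 / B i` is at most `2 h i / t`. So the harmonic mean is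
at least `t / (2H)`, while the threshold is at most `ρ / n + 1`. -/
theorem batchesSuffice_of_le {n : ℕ} (hn : 0 < n) (h : Fin n → ℝ) (hpos : ∀ i, 0 < h i)
    {ρ t : ℝ} (hρ : 0 ≤ ρ) (ht : ∀ i, h i ≤ t)
    (hmean : 2 * ((1 / (n : ℝ)) * ∑ i, h i) * (ρ / n + 1) ≤ t) :
    BatchesSuffice ρ (batchSize h t) := by
  have hn' : (0 : ℝ) < n := by exact_mod_cast hn
  have : NeZero n := ⟨hn.ne'⟩
  have htpos : 0 < t := (hpos 0).trans_le (ht 0)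
  have hB : ∀ i, 1 ≤ batchSize h t i := fun i =>
    Nat.le_floor (by rw [Nat.cast_one, le_div_iff₀ (hpos i)]; linarith [ht i])
  have hB' : ∀ i, 1 / (batchSize h t i : ℝ) ≤ 2 / t * h i := by
    intro i
    have h1 : (1 : ℝ) ≤ batchSize h t i := by exact_mod_cast hB i
    have h2 : t / h i < batchSize h t i + 1 := Nat.lt_floor_add_one _
    rw [div_lt_iff₀ (hpos i)] at h2
    rw [div_le_iff₀ (by linarith), div_mul_eq_mul_div, div_mul_eq_mul_div, le_div_iff₀ htpos]
    nlinarith [hpos i]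
  refine ⟨hB, ?_⟩
  set H := (1 / (n : ℝ)) * ∑ i, h i with hH
  have hHpos : 0 < H := by
    have : 0 < ∑ i, h i := Finset.sum_pos (fun i _ => hpos i) Finset.univ_nonempty
    positivity
  have hsum : (1 / (n : ℝ)) * ∑ i, 1 / (batchSize h t i : ℝ) ≤ 2 / t * H := by
    calc (1 / (n : ℝ)) * ∑ i, 1 / (batchSize h t i : ℝ)
        ≤ (1 / (n : ℝ)) * ∑ i, 2 / t * h i := by gcongr with i; exact hB' i
      _ = 2 / t * H := by rw [hH, ← Finset.mul_sum]; ring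
  have hsumpos : 0 < (1 / (n : ℝ)) * ∑ i, 1 / (batchSize h t i : ℝ) := by
    have : 0 < ∑ i, 1 / (batchSize h t i : ℝ) := Finset.sum_pos
      (fun i _ => by have := hB i; positivity) Finset.univ_nonempty
    positivity
  calc max (⌈ρ⌉₊ : ℝ) (n : ℝ) / n ≤ (ρ + n) / n := by
        gcongr
        have h1 : (1 : ℝ) ≤ n := by exact_mod_cast hn
        exact max_le ((Nat.ceil_lt_add_one hρ).le.trans (by linarith)) (by linarith)
    _ = ρ / n + 1 := by field_simp
    _ ≤ (2 / t * H)⁻¹ := by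
        rw [← one_div, le_div_iff₀ (by positivity), div_mul_eq_mul_div, mul_div_assoc', div_le_one htpos]
        linarith
    _ ≤ _ := inv_anti₀ hsumpos hsum

theorem exists_isCollectTime_le {n : ℕ} (hn : 0 < n) (h : Fin n → ℝ) (hpos : ∀ i, 0 < h i)
    {ρ : ℝ} (hρ : 0 ≤ ρ) : ∃ τ, IsCollectTime h ρ τ ∧
      τ ≤ 4 * max (⨆ i, h i) (ρ / n * ((1 / (n : ℝ)) * ∑ i, h i)) := by
  have hn' : (0 : ℝ) < n := by exact_mod_cast hn
  have : NeZero n := ⟨hn.ne'⟩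
  set H := (1 / (n : ℝ)) * ∑ i, h i with hH
  set M := max (⨆ i, h i) (ρ / n * H) with hM
  have hle : ∀ i, h i ≤ M := fun i => (le_ciSup (Finite.bddAbove_range h) i).trans (le_max_left _ _)
  have hM0 : 0 < M := (hpos 0).trans_le (hle 0)
  have hHM : H ≤ M := by
    have : ∑ i, h i ≤ ∑ _i : Fin n, M := Finset.sum_le_sum fun i _ => hle i
    rw [Finset.sum_const, Finset.card_univ, Fintype.card_fin, nsmul_eq_mul] at this
    rw [hH, one_div, inv_mul_le_iff₀ hn']
    exact this
  -- At `t = 4M`, both `H ≤ M` and `(ρ / n) H ≤ M` hold, hence `2H(ρ / n + 1) ≤ 4M`.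
  refine exists_isCollectTime h hpos (by positivity) (batchesSuffice_of_le hn h hpos hρ ?_ ?_)
  · intro i; linarith [hle i]
  · have : ρ / n * H ≤ M := le_max_right _ _
    rw [← hH]
    linarith

end Collect

/-! ### Minimum cuts and Gomory–Hu trees -/

namespace BandwidthGraph

variable {n : ℕ} (G : BandwidthGraph n)

theorem exists_bw_pos_of_mem_of_notMem {U : Set (Fin n)} {a b : Fin n} (ha : a ∈ U)
    (hb : b ∉ U) : ∃ u v, u ∈ U ∧ v ∉ U ∧ 0 < G.bw u v := by
  obtain ⟨p⟩ := G.connected.preconnected a b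
  obtain ⟨d, -, h1, h2⟩ := p.exists_boundary_dart U ha hb
  refine ⟨d.fst, d.snd, h1, h2, ?_⟩
  have := d.adj
  rw [SimpleGraph.fromRel_adj] at this
  rcases this.2 with h | h
  · exact h
  · rw [G.bw_symm]; exact h

theorem cutValue_pos {U : Finset (Fin n)} (h1 : U.Nonempty) (h2 : U ≠ Finset.univ) :
    0 < G.cutValue U := by
  obtain ⟨a, ha⟩ := h1
  obtain ⟨b, hb⟩ : ∃ b, b ∉ U := by
    by_contra! h
    exact h2 (Finset.eq_univ_iff_forall.mpr h)
  obtain ⟨u, v, hu, hv, huv⟩ := G.exists_bw_pos_of_mem_of_notMem (U := U) ha hb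
  refine Finset.sum_pos' (fun i _ => Finset.sum_nonneg fun j _ => G.bw_nonneg i j) ⟨u, hu, ?_⟩
  exact Finset.sum_pos' (fun j _ => G.bw_nonneg u j) ⟨v, by simpa using hv, huv⟩

theorem minCut_le {U : Finset (Fin n)} (h1 : U.Nonempty) (h2 : U ≠ Finset.univ) :
    G.minCut ≤ ENNReal.ofReal (G.cutValue U) :=
  iInf_le_of_le U (iInf_le_of_le h1 (iInf_le_of_le h2 le_rfl))

theorem exists_minCut_eq (hn : 2 ≤ n) : ∃ w : ℝ, 0 < w ∧ G.minCut = ENNReal.ofReal w ∧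
    ∀ U : Finset (Fin n), U.Nonempty → U ≠ Finset.univ → w ≤ G.cutValue U := by
  classical
  let 𝒰 : Finset (Finset (Fin n)) := Finset.univ.filter fun U => U.Nonempty ∧ U ≠ Finset.univ
  have hne : 𝒰.Nonempty := by
    have : Nontrivial (Fin n) := Fin.nontrivial_iff_two_le.mpr hn
    obtain ⟨a, b, hab⟩ := exists_pair_ne (Fin n)
    refine ⟨{a}, ?_⟩
    simp only [𝒰, Finset.mem_filter, Finset.mem_univ, true_and, Finset.singleton_nonempty]
    intro h
    have := Finset.mem_univ b
    rw [← h, Finset.mem_singleton] at this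
    exact hab this.symm
  obtain ⟨U, hU, hmin⟩ := Finset.exists_min_image 𝒰 G.cutValue hne
  simp only [𝒰, Finset.mem_filter, Finset.mem_univ, true_and] at hU hmin
  refine ⟨G.cutValue U, G.cutValue_pos hU.1 hU.2, le_antisymm (G.minCut_le hU.1 hU.2) ?_,
    fun V h1 h2 => hmin V ⟨h1, h2⟩⟩
  exact le_iInf fun V => le_iInf fun h1 => le_iInf fun h2 =>
    ENNReal.ofReal_le_ofReal (hmin V ⟨h1, h2⟩)

/-- Any cut `U` is crossed by some tree edge, whose weight is a minimum cut between its ends and so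
at most the value of `U`. Conversely a tree edge is a bridge of the tree, so its weight is the value
of a genuine cut. -/
theorem iInf_gomoryHu_weight_eq_minCut {T : SimpleGraph (Fin n)} {w : Sym2 (Fin n) → ℝ}
    (hT : G.IsGomoryHuTree T w) : (⨅ e ∈ T.edgeSet, ENNReal.ofReal (w e)) = G.minCut := by
  apply le_antisymm
  · refine le_iInf fun U => le_iInf fun h1 => le_iInf fun h2 => ?_
    obtain ⟨a, ha⟩ := h1
    obtain ⟨b, hb⟩ : ∃ b, b ∉ U := by
      by_contra! h
      exact h2 (Finset.eq_univ_iff_forall.mpr h)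
    obtain ⟨p⟩ := hT.isTree.connected.preconnected a b
    obtain ⟨e, -, hu, hv⟩ := p.exists_boundary_dart (U : Set (Fin n)) ha hb
    refine iInf₂_le_of_le s(e.fst, e.snd) e.adj ?_
    rw [hT.weight _ _ e.adj]
    exact ENNReal.ofReal_le_ofReal (hT.minimum _ _ e.adj U hu hv)
  · refine le_iInf₂ fun e he => ?_
    induction e with
    | h i j =>
      have hij : T.Adj i j := he
      rw [hT.weight i j hij]
      refine G.minCut_le ⟨i, by simp [treeSide]⟩ fun h => ?_
      have hj := Finset.mem_univ j
      rw [← h] at hj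
      simp only [treeSide, Finset.mem_filter, Finset.mem_univ, true_and] at hj
      exact SimpleGraph.isBridge_iff.mp
        (SimpleGraph.isAcyclic_iff_forall_adj_isBridge.mp hT.isTree.isAcyclic hij) hj

end BandwidthGraph

/-! ### Fractional packing of spanning trees -/

namespace BandwidthGraph

variable {n : ℕ} (G : BandwidthGraph n)

/-- The links in `X` connect the classes of workers with the same label `π`: no nonempty proper
subset of the workers is a union of classes that no link in `X` leaves. -/
def Connects {n : ℕ} (π : Fin n → Fin n) (X : Finset (Fin n × Fin n)) : Prop :=
  ∀ S : Set (Fin n), (∀ u v, π u = π v → u ∈ S → v ∈ S) → (∀ e ∈ X, e.1 ∈ S ↔ e.2 ∈ S) →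
    S.Nonempty → S = Set.univ

/-- Grouping the ordered pairs by the class of the first entry turns the right side into the sum of
the cut values of the classes, each at least `w`. -/
theorem card_mul_le_sum_crossing {w : ℝ}
    (hw : ∀ U : Finset (Fin n), U.Nonempty → U ≠ Finset.univ → w ≤ G.cutValue U)
    (π : Fin n → Fin n) (hπ : 2 ≤ (Finset.univ.image π).card) :
    (Finset.univ.image π).card * w ≤ ∑ u, ∑ v, if π u ≠ π v then G.bw u v else 0 := by
  classical
  rw [← Finset.sum_fiberwise_of_maps_to (g := π) (t := Finset.univ.image π)
    (fun u _ => Finset.mem_image_of_mem π (Finset.mem_univ u)), ← nsmul_eq_mul]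
  refine Finset.card_nsmul_le_sum _ _ _ fun c hc => ?_
  obtain ⟨a, -, rfl⟩ := Finset.mem_image.mp hc
  refine (hw (Finset.univ.filter fun x => π x = π a) ⟨a, by simp⟩ fun h => ?_).trans_eq ?_
  · have hall : ∀ x, π x = π a := fun x => by
      have := Finset.mem_univ x
      rw [← h] at this
      simpa using this
    have : Finset.univ.image π ⊆ {π a} := by
      intro c hc
      obtain ⟨x, -, rfl⟩ := Finset.mem_image.mp hc
      simp [hall x]
    have := Finset.card_le_card this
    simp only [Finset.card_singleton] at this
    omega
  · unfold cutValue
    refine Finset.sum_congr rfl fun u hu => ?_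
    rw [← Finset.sum_filter]
    refine Finset.sum_congr ?_ fun _ _ => rfl
    ext v
    simp only [Finset.mem_filter, Finset.mem_univ, true_and] at hu
    simp [hu, eq_comm]

/-- The dual form of tree packing, by induction on the number of classes. Merge the two classes
joined by a cheapest crossing link, of cost `m`, and lower all costs by `m`. With `k + 2` classes,
the right side drops by at least `m(k + 2)w`; restoring the costs on the left adds at most `m(k +
1)w`, since at most `k + 1` links are chosen. -/
theorem exists_connects_mul_sum_le {w : ℝ} (hw0 : 0 ≤ w)
    (hw : ∀ U : Finset (Fin n), U.Nonempty → U ≠ Finset.univ → w ≤ G.cutValue U) (k : ℕ)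
    (π : Fin n → Fin n) (y : Fin n → Fin n → ℝ) (hk : (Finset.univ.image π).card = k + 1)
    (hy : ∀ u v, 0 < G.bw u v → π u ≠ π v → 0 ≤ y u v) :
    ∃ X : Finset (Fin n × Fin n), Connects π X ∧ X.card ≤ k ∧ (∀ e ∈ X, 0 < G.bw e.1 e.2) ∧
      (∀ e ∈ X, π e.1 ≠ π e.2) ∧
      w * ∑ e ∈ X, y e.1 e.2 ≤ ∑ u, ∑ v, if π u ≠ π v then G.bw u v * y u v else 0 := by
  classical
  induction k generalizing π y with
  | zero =>
    rw [zero_add, Finset.card_eq_one] at hk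
    obtain ⟨c, hc⟩ := hk
    have hall : ∀ x, π x = c := fun x => by
      have := Finset.mem_image_of_mem π (Finset.mem_univ x)
      rwa [hc, Finset.mem_singleton] at this
    refine ⟨∅, ?_, by simp, by simp, by simp, by simp [hall]⟩
    rintro S hS - ⟨u, hu⟩
    exact Set.eq_univ_of_forall fun v => hS u v (by simp [hall]) hu
  | succ k ih =>
    let E : Finset (Fin n × Fin n) :=
      Finset.univ.filter fun e => 0 < G.bw e.1 e.2 ∧ π e.1 ≠ π e.2
    have hE : E.Nonempty := by
      obtain ⟨c₁, h₁, c₂, h₂, hne⟩ := Finset.one_lt_card.mp (by omega : 1 < (Finset.univ.image π).card)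
      obtain ⟨a, -, rfl⟩ := Finset.mem_image.mp h₁
      obtain ⟨b, -, rfl⟩ := Finset.mem_image.mp h₂
      obtain ⟨u, v, hu, hv, huv⟩ := G.exists_bw_pos_of_mem_of_notMem (U := {x | π x = π a}) (a := a)
        (b := b) rfl (fun h => hne h.symm)
      refine ⟨(u, v), ?_⟩
      simp only [E, Finset.mem_filter, Finset.mem_univ, true_and]
      exact ⟨huv, fun h => hv (h.symm.trans hu)⟩
    obtain ⟨⟨a, b⟩, hab, hmin⟩ := Finset.exists_min_image E (fun e => y e.1 e.2) hE
    simp only [E, Finset.mem_filter, Finset.mem_univ, true_and, Prod.forall] at hab hmin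
    set m := y a b with hm
    have hm0 : 0 ≤ m := hy a b hab.1 hab.2
    let π' : Fin n → Fin n := fun x => if π x = π a then π b else π x
    have hπ' : ∀ u v, π' u ≠ π' v → π u ≠ π v := by
      intro u v h h'
      exact h (by simp only [π', h'])
    have himg : Finset.univ.image π' = (Finset.univ.image π).erase (π a) := by
      ext c
      simp only [Finset.mem_image, Finset.mem_univ, true_and, Finset.mem_erase, π']
      constructor
      · rintro ⟨x, rfl⟩
        split_ifs with h
        · exact ⟨hab.2.symm, b, rfl⟩
        · exact ⟨h, x, rfl⟩
      · rintro ⟨h, x, rfl⟩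
        exact ⟨x, by simp [h]⟩
    have hcard : (Finset.univ.image π').card = k + 1 := by
      rw [himg, Finset.card_erase_of_mem (Finset.mem_image_of_mem π (Finset.mem_univ a)), hk]
      rfl
    -- Lowered costs stay nonnegative on links that cross the coarser partition, because `m` is
    -- minimal among all links crossing `π`. Elsewhere they may be negative, which is why `hy` is
    -- restricted to crossing links.
    obtain ⟨X, hX, hXk, hXb, hXπ, hXsum⟩ := ih π' (fun u v => y u v - m) hcard fun u v h h' =>
      sub_nonneg.mpr (hmin u v ⟨h, hπ' u v h'⟩)
    have habX : (a, b) ∉ X := fun h => hXπ _ h (by simp [π'])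
    refine ⟨insert (a, b) X, ?_, ?_, ?_, ?_, ?_⟩
    · intro S hS hXS
      have hab' : a ∈ S ↔ b ∈ S := hXS (a, b) (Finset.mem_insert_self _ _)
      refine hX S (fun u v huv hu => ?_) fun e he => hXS e (Finset.mem_insert_of_mem he)
      simp only [π'] at huv
      split_ifs at huv with h1 h2 h2
      · exact hS u v (h1.trans h2.symm) hu
      · exact hS b v huv (hab'.mp (hS u a h1 hu))
      · exact hS a v h2.symm (hab'.mpr (hS u b huv hu))
      · exact hS u v huv hu
    · rw [Finset.card_insert_of_notMem habX]; omega
    · intro e he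
      rcases Finset.mem_insert.mp he with rfl | he
      · exact hab.1
      · exact hXb e he
    · intro e he
      rcases Finset.mem_insert.mp he with rfl | he
      · exact hab.2
      · exact hπ' _ _ (hXπ e he)
    · rw [Finset.sum_insert habX]
      have h1 : (∑ u, ∑ v, if π' u ≠ π' v then G.bw u v * (y u v - m) else 0) ≤
          ∑ u, ∑ v, if π u ≠ π v then G.bw u v * (y u v - m) else 0 := by
        refine Finset.sum_le_sum fun u _ => Finset.sum_le_sum fun v _ => ?_
        by_cases h : π' u ≠ π' v
        · rw [if_pos h, if_pos (hπ' u v h)]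
        · rw [if_neg h]
          split_ifs with h'
          · rcases (G.bw_nonneg u v).eq_or_lt with h0 | h0
            · rw [← h0, zero_mul]
            · exact mul_nonneg h0.le (sub_nonneg.mpr (hmin u v ⟨h0, h'⟩))
          · exact le_rfl
      have h2 : (∑ u, ∑ v, if π u ≠ π v then G.bw u v * (y u v - m) else 0) =
          (∑ u, ∑ v, if π u ≠ π v then G.bw u v * y u v else 0) -
            m * ∑ u, ∑ v, if π u ≠ π v then G.bw u v else 0 := by
        rw [Finset.mul_sum, ← Finset.sum_sub_distrib]
        refine Finset.sum_congr rfl fun u _ => ?_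
        rw [Finset.mul_sum, ← Finset.sum_sub_distrib]
        refine Finset.sum_congr rfl fun v _ => ?_
        split_ifs <;> ring
      have h3 := G.card_mul_le_sum_crossing hw π (by omega)
      rw [hk] at h3
      have h4 := mul_le_mul_of_nonneg_left h3 hm0
      have h5 : w * (m + ∑ e ∈ X, y e.1 e.2) =
          w * ∑ e ∈ X, (y e.1 e.2 - m) + m * (((X.card : ℝ) + 1) * w) := by
        rw [Finset.sum_sub_distrib, Finset.sum_const, nsmul_eq_mul]; ring
      have h6 : m * (((X.card : ℝ) + 1) * w) ≤ m * (((k + 1 + 1 : ℕ) : ℝ) * w) := by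
        have : (X.card : ℝ) ≤ k := by exact_mod_cast hXk
        gcongr
        push_cast
        linarith
      change w * (m + ∑ e ∈ X, y e.1 e.2) ≤ _
      linarith

/-- The undirected indicator function of a set of links. -/
def linkIndicator {n : ℕ} (X : Finset (Fin n × Fin n)) (e : Fin n × Fin n) : ℝ :=
  open Classical in if e ∈ X ∨ e.swap ∈ X then 1 else 0

/-- A chosen link is charged in both directions, so the contraction lemma is applied to the cost `y
(u, v) + y (v, u)`; by symmetry of `bw` this doubles the right side. -/
theorem exists_connects_mul_sum_linkIndicator_le [NeZero n] {w : ℝ} (hw0 : 0 ≤ w)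
    (hw : ∀ U : Finset (Fin n), U.Nonempty → U ≠ Finset.univ → w ≤ G.cutValue U)
    (y : Fin n × Fin n → ℝ) (hy : ∀ e, 0 ≤ y e) :
    ∃ X : Finset (Fin n × Fin n), Connects id X ∧ (∀ e ∈ X, 0 < G.bw e.1 e.2) ∧
      w * ∑ e, y e * linkIndicator X e ≤ 2 * ∑ e, y e * G.bw e.1 e.2 := by
  classical
  obtain ⟨X, hX, -, hXb, -, hsum⟩ := G.exists_connects_mul_sum_le hw0 hw (n - 1) id
    (fun u v => y (u, v) + y (v, u)) (by
      rw [Finset.image_id, Finset.card_univ, Fintype.card_fin]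
      have := NeZero.pos n
      omega) (fun u v _ _ => add_nonneg (hy _) (hy _))
  refine ⟨X, hX, hXb, ?_⟩
  have hswap : ∀ F : Fin n × Fin n → ℝ, ∑ e : Fin n × Fin n, F e.swap = ∑ e, F e := fun F =>
    Equiv.sum_comp (Equiv.prodComm _ _) F
  have h1 : ∑ e, y e * linkIndicator X e ≤ ∑ e ∈ X, (y (e.1, e.2) + y (e.2, e.1)) := by
    calc ∑ e, y e * linkIndicator X e
        ≤ ∑ e, ((if e ∈ X then y e else 0) + (if e.swap ∈ X then y e else 0)) := by
          refine Finset.sum_le_sum fun e _ => ?_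
          have := hy e
          unfold linkIndicator
          by_cases h1 : e ∈ X <;> by_cases h2 : e.swap ∈ X <;> simp [h1, h2, this]
      _ = ∑ e, (if e ∈ X then y e else 0) + ∑ e, (if e ∈ X then y e.swap else 0) := by
          rw [Finset.sum_add_distrib, ← hswap fun e : Fin n × Fin n => if e ∈ X then y e.swap else 0]
          simp
      _ = ∑ e ∈ X, (y (e.1, e.2) + y (e.2, e.1)) := by
          rw [Finset.sum_add_distrib]
          simp [Prod.swap]
  have h2 : (∑ u, ∑ v, if id u ≠ id v then G.bw u v * (y (u, v) + y (v, u)) else 0) ≤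
      2 * ∑ e, y e * G.bw e.1 e.2 := by
    calc (∑ u, ∑ v, if id u ≠ id v then G.bw u v * (y (u, v) + y (v, u)) else 0)
        ≤ ∑ u, ∑ v, G.bw u v * (y (u, v) + y (v, u)) := by
          refine Finset.sum_le_sum fun u _ => Finset.sum_le_sum fun v _ => ?_
          split_ifs
          · exact le_rfl
          · exact mul_nonneg (G.bw_nonneg u v) (add_nonneg (hy _) (hy _))
      _ = ∑ e : Fin n × Fin n, y e * G.bw e.1 e.2 +
            ∑ e : Fin n × Fin n, y e.swap * G.bw e.swap.1 e.swap.2 := by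
          rw [← Finset.sum_add_distrib, Fintype.sum_prod_type]
          refine Finset.sum_congr rfl fun u _ => Finset.sum_congr rfl fun v _ => ?_
          simp only [Prod.swap, G.bw_symm v u]
          ring
      _ = 2 * ∑ e, y e * G.bw e.1 e.2 := by
          rw [hswap fun e => y e * G.bw e.1 e.2]; ring
  exact (mul_le_mul_of_nonneg_left h1 hw0).trans (hsum.trans h2)

/-- A fractional packing of connected spanning subgraphs, of value half the minimum cut (here
scaled to a convex combination). -/
theorem exists_connects_packing [NeZero n] {w : ℝ} (hw0 : 0 < w)
    (hw : ∀ U : Finset (Fin n), U.Nonempty → U ≠ Finset.univ → w ≤ G.cutValue U) :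
    ∃ (N : ℕ) (X : ℕ → Finset (Fin n × Fin n)) (μ : ℕ → ℝ),
      (∀ j < N, Connects id (X j) ∧ ∀ e ∈ X j, 0 < G.bw e.1 e.2) ∧ (∀ j < N, 0 ≤ μ j) ∧
      ∑ j ∈ Finset.range N, μ j = 1 ∧
      ∀ e, w * ∑ j ∈ Finset.range N, μ j * linkIndicator (X j) e ≤ 2 * G.bw e.1 e.2 := by
  classical
  let 𝒳 : Finset (Finset (Fin n × Fin n)) :=
    Finset.univ.filter fun X => Connects id X ∧ ∀ e ∈ X, 0 < G.bw e.1 e.2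
  let s : Finset (Fin n × Fin n → ℝ) := 𝒳.image linkIndicator
  let Q : Set (Fin n × Fin n → ℝ) := {x | ∀ e, w * x e ≤ 2 * G.bw e.1 e.2}
  -- Minimax argument: a functional separating the hull of the indicators from the capacity
  -- polyhedron `Q` would yield link costs `-φ (Pi.single e 1)` for which no connected spanning set
  -- is cheap enough.
  have hQ : ¬ Disjoint (convexHull ℝ (s : Set (Fin n × Fin n → ℝ))) Q := by
    intro hdisj
    have hQconv : Convex ℝ Q := by
      intro x hx x' hx' a b ha hb hab e
      have h1 := mul_le_mul_of_nonneg_left (hx e) ha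
      have h2 := mul_le_mul_of_nonneg_left (hx' e) hb
      have h3 : a * (2 * G.bw e.1 e.2) + b * (2 * G.bw e.1 e.2) = 2 * G.bw e.1 e.2 := by
        rw [← add_mul, hab, one_mul]
      simp only [Pi.add_apply, Pi.smul_apply, smul_eq_mul]
      linarith
    have hQcl : IsClosed Q := by
      simp only [Q, Set.ofPred_forall]
      exact isClosed_iInter fun e => isClosed_le (by fun_prop) (by fun_prop)
    obtain ⟨φ, a, b, ha, hab, hb⟩ := geometric_hahn_banach_compact_closed (convex_convexHull ℝ _)
      (s.finite_toSet.isCompact_convexHull (𝕜 := ℝ)) hQconv hQcl hdisj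
    have hφ : ∀ x, φ x = ∑ e, x e * φ (Pi.single e 1) := by
      intro x
      conv_lhs => rw [pi_eq_sum_univ' x]
      simp [map_sum, Pi.single]
    let x₀ : Fin n × Fin n → ℝ := fun e => 2 * G.bw e.1 e.2 / w
    -- `Q` is closed under decreasing coordinates, so a positive coefficient would push `φ` below
    -- `b` inside `Q`.
    have hneg : ∀ e, 0 ≤ -φ (Pi.single e 1) := by
      intro e
      by_contra! h
      have h' : 0 < φ (Pi.single e 1) := by linarith
      set M := max 0 ((φ x₀ - b) / φ (Pi.single e 1)) with hM
      have hmem : x₀ - M • (Pi.single e 1 : Fin n × Fin n → ℝ) ∈ Q := by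
        intro e'
        have h0 : 0 ≤ M * (Pi.single e 1 : Fin n × Fin n → ℝ) e' :=
          mul_nonneg (le_max_left _ _) (by rw [Pi.single_apply]; split_ifs <;> norm_num)
        have h1 : w * x₀ e' = 2 * G.bw e'.1 e'.2 := by simp only [x₀]; field_simp
        simp only [Pi.sub_apply, Pi.smul_apply, smul_eq_mul, mul_sub, h1]
        have := mul_nonneg hw0.le h0
        linarith
      have h1 := hb _ hmem
      rw [map_sub, map_smul, smul_eq_mul] at h1
      have h2 : (φ x₀ - b) / φ (Pi.single e 1) ≤ M := le_max_right _ _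
      rw [div_le_iff₀ h'] at h2
      linarith
    obtain ⟨X, hX, hXb, hXsum⟩ := G.exists_connects_mul_sum_linkIndicator_le hw0.le hw _ hneg
    have h1 : φ (linkIndicator X) < a := ha _ (subset_convexHull ℝ _ (by
      simp only [s, 𝒳, Finset.coe_image, Finset.coe_filter, Finset.mem_univ, true_and]
      exact ⟨X, ⟨hX, hXb⟩, rfl⟩))
    have h2 : b < φ x₀ := hb _ fun e => by simp only [x₀]; field_simp; exact le_rfl
    have h3 : ∑ e, -φ (Pi.single e 1) * linkIndicator X e = - φ (linkIndicator X) := by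
      rw [hφ, ← Finset.sum_neg_distrib]
      exact Finset.sum_congr rfl fun e _ => by ring
    have h4 : 2 * ∑ e : Fin n × Fin n, -φ (Pi.single e 1) * G.bw e.1 e.2 = - (w * φ x₀) := by
      rw [hφ, Finset.mul_sum, Finset.mul_sum, ← Finset.sum_neg_distrib]
      refine Finset.sum_congr rfl fun e _ => ?_
      simp only [x₀]
      field_simp
    rw [h3, h4] at hXsum
    nlinarith
  obtain ⟨x, hx, hxQ⟩ := Set.not_disjoint_iff.mp hQ
  obtain ⟨μ, hμ0, hμ1, hμx⟩ := Finset.mem_convexHull'.mp hx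
  have hs : ∀ z : s, ∃ X, (Connects id X ∧ ∀ e ∈ X, 0 < G.bw e.1 e.2) ∧ linkIndicator X = z := by
    rintro ⟨z, hz⟩
    obtain ⟨X, hX, rfl⟩ := Finset.mem_image.mp hz
    exact ⟨X, (Finset.mem_filter.mp hX).2, rfl⟩
  choose X hX hXind using hs
  let e := s.equivFin.symm
  refine ⟨s.card, fun j => if h : j < s.card then X (e ⟨j, h⟩) else ∅,
    fun j => if h : j < s.card then μ (e ⟨j, h⟩) else 0, ?_, ?_, ?_, ?_⟩
  · intro j hj
    simp only [hj, dif_pos]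
    exact hX _
  · intro j hj
    simp only [hj, dif_pos]
    exact hμ0 _ (e ⟨j, hj⟩).2
  · rw [Finset.sum_range]
    simp only [Fin.is_lt, dif_pos, Fin.eta]
    rw [Equiv.sum_comp e fun z => μ z, ← hμ1]
    exact Finset.sum_coe_sort s μ
  · intro p
    refine le_trans (le_of_eq ?_) (hxQ p)
    rw [Finset.sum_range]
    simp only [Fin.is_lt, dif_pos, Fin.eta, hXind]
    rw [Equiv.sum_comp e fun z => μ z * (z : Fin n × Fin n → ℝ) p, ← hμx, Finset.sum_apply]
    congr 1
    exact Finset.sum_coe_sort s fun z => μ z * z p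

/-- The parent function `p` describes a tree with root `r` on the workers, with depth `D`. -/
structure IsRootedTree {n : ℕ} (r : Fin n) (p : Fin n → Fin n) (D : Fin n → ℕ) : Prop where
  depth_root : D r = 0
  depth_parent : ∀ v, v ≠ r → D v = D (p v) + 1
  depth_lt : ∀ v, D v < n

/-- The rooted tree with parent function `p` has the edge `{u, v}`. -/
def TreeEdge {n : ℕ} (r : Fin n) (p : Fin n → Fin n) (u v : Fin n) : Prop :=
  (u ≠ r ∧ p u = v) ∨ (v ≠ r ∧ p v = u)

theorem TreeEdge.symm {n : ℕ} {r : Fin n} {p : Fin n → Fin n} {u v : Fin n}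
    (h : TreeEdge r p u v) : TreeEdge r p v u := Or.symm h

/-- A breadth-first tree: the parent of `v` is a neighbour one step closer to `r`, and the depth is
the graph distance, which a path realises and which is therefore below `n`. -/
theorem Connects.exists_isRootedTree {n : ℕ} {X : Finset (Fin n × Fin n)} (hX : Connects id X)
    (r : Fin n) : ∃ p D, IsRootedTree r p D ∧ ∀ u v, TreeEdge r p u v → (u, v) ∈ X ∨ (v, u) ∈ X := by
  classical
  let T : SimpleGraph (Fin n) := SimpleGraph.fromRel fun u v => (u, v) ∈ X
  have hreach : ∀ v, T.Reachable r v := by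
    have := hX {v | T.Reachable r v} (fun u v huv hu => by rw [← show u = v from huv]; exact hu)
      (fun e he => by
        rcases eq_or_ne e.1 e.2 with h | h
        · rw [h]
        · have hadj : T.Adj e.1 e.2 := by
            rw [SimpleGraph.fromRel_adj]
            exact ⟨h, Or.inl he⟩
          exact ⟨fun h => SimpleGraph.Reachable.trans h hadj.reachable,
            fun h => SimpleGraph.Reachable.trans h hadj.symm.reachable⟩)
      ⟨r, SimpleGraph.Reachable.refl r⟩
    intro v
    have hv := Set.mem_univ v
    rwa [← this] at hv
  have hpar : ∀ v, ∃ u, v ≠ r → T.Adj v u ∧ T.dist r v = T.dist r u + 1 := by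
    intro v
    by_cases hv : v = r
    · exact ⟨r, fun h => (h hv).elim⟩
    obtain ⟨q, hq⟩ := (hreach v).symm.exists_walk_length_eq_dist
    cases q with
    | nil => exact (hv rfl).elim
    | cons hadj q =>
      rename_i u
      refine ⟨u, fun _ => ⟨hadj, ?_⟩⟩
      rw [SimpleGraph.Walk.length_cons] at hq
      have h1 : T.dist u r ≤ q.length := SimpleGraph.dist_le q
      have h2 : T.dist v r ≤ T.dist u r + 1 := by
        obtain ⟨q', hq'⟩ := (hreach u).symm.exists_walk_length_eq_dist
        have := SimpleGraph.dist_le (SimpleGraph.Walk.cons hadj q')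
        rwa [SimpleGraph.Walk.length_cons, hq'] at this
      rw [SimpleGraph.dist_comm, SimpleGraph.dist_comm (u := r) (v := u)]
      omega
  choose p hp using hpar
  refine ⟨p, T.dist r, ⟨SimpleGraph.dist_self, fun v hv => (hp v hv).2, fun v => ?_⟩, ?_⟩
  · obtain ⟨q, hq, hlen⟩ := (hreach v).exists_path_of_dist
    have := hq.length_lt
    rwa [hlen, Fintype.card_fin] at this
  · rintro u v (⟨h, rfl⟩ | ⟨h, rfl⟩)
    · have := (hp u h).1
      rw [SimpleGraph.fromRel_adj] at this
      exact this.2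
    · have := (hp v h).1
      rw [SimpleGraph.fromRel_adj] at this
      exact this.2.symm

open Classical in
/-- A fractional packing of spanning trees, of value half the minimum cut (here scaled to a convex
combination). -/
theorem exists_tree_packing {w : ℝ} (hw0 : 0 < w)
    (hw : ∀ U : Finset (Fin n), U.Nonempty → U ≠ Finset.univ → w ≤ G.cutValue U) (r : Fin n) :
    ∃ (N : ℕ) (p : ℕ → Fin n → Fin n) (D : ℕ → Fin n → ℕ) (μ : ℕ → ℝ),
      (∀ j < N, IsRootedTree r (p j) (D j)) ∧
      (∀ j < N, ∀ u v, TreeEdge r (p j) u v → 0 < G.bw u v) ∧ (∀ j < N, 0 ≤ μ j) ∧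
      ∑ j ∈ Finset.range N, μ j = 1 ∧
      ∀ u v, w * ∑ j ∈ Finset.range N, (if TreeEdge r (p j) u v then μ j else 0) ≤
        2 * G.bw u v := by
  have : NeZero n := ⟨by have := r.pos; omega⟩
  obtain ⟨N, X, μ, hX, hμ0, hμ1, hload⟩ := G.exists_connects_packing hw0 hw
  have hT : ∀ j, ∃ p D, j < N → IsRootedTree r p D ∧
      ∀ u v, TreeEdge r p u v → (u, v) ∈ X j ∨ (v, u) ∈ X j := by
    intro j
    by_cases hj : j < N
    · obtain ⟨p, D, h⟩ := (hX j hj).1.exists_isRootedTree r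
      exact ⟨p, D, fun _ => h⟩
    · exact ⟨id, fun _ => 0, fun h => (hj h).elim⟩
  choose p D hpD using hT
  refine ⟨N, p, D, μ, fun j hj => (hpD j hj).1, fun j hj u v huv => ?_, hμ0, hμ1, fun u v => ?_⟩
  · rcases (hpD j hj).2 u v huv with h | h
    · exact (hX j hj).2 _ h
    · rw [G.bw_symm]
      exact (hX j hj).2 _ h
  · refine le_trans (mul_le_mul_of_nonneg_left (Finset.sum_le_sum fun j hj => ?_) hw0.le)
      (hload (u, v))
    have hj := Finset.mem_range.mp hj
    have h0 := hμ0 j hj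
    unfold linkIndicator
    split_ifs with h1 h2 h2
    · rw [mul_one]
    · exact (h2 ((hpD j hj).2 u v h1)).elim
    · rwa [mul_one]
    · rw [mul_zero]

end BandwidthGraph

/-! ### Pipelined AllReduce along the packed trees -/

namespace BandwidthGraph

namespace IsRootedTree

variable {n : ℕ} {r : Fin n} {p : Fin n → Fin n} {D : Fin n → ℕ}

theorem eq_root (hT : IsRootedTree r p D) {v : Fin n} (hv : D v = 0) : v = r := by
  by_contra h
  have := hT.depth_parent v h
  omega

theorem depth_iterate (hT : IsRootedTree r p D) (x : Fin n) (k : ℕ) (hk : k ≤ D x) :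
    D (p^[k] x) = D x - k := by
  induction k with
  | zero => simp
  | succ k ih =>
    have h1 := ih (by omega)
    have h2 : p^[k] x ≠ r := fun h => by
      rw [h, hT.depth_root] at h1
      omega
    have h3 := hT.depth_parent _ h2
    rw [Function.iterate_succ_apply']
    omega

end IsRootedTree

/-- The descendants of `v` (including `v`) in the tree with parent function `p` and depth `D`. -/
def descendants {n : ℕ} (p : Fin n → Fin n) (D : Fin n → ℕ) (v : Fin n) : Finset (Fin n) :=
  Finset.univ.filter fun x => D v ≤ D x ∧ p^[D x - D v] x = v

/-- The children of `v` in the tree with root `r` and parent function `p`. -/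
def children {n : ℕ} (r : Fin n) (p : Fin n → Fin n) (v : Fin n) : Finset (Fin n) :=
  Finset.univ.filter fun c => c ≠ r ∧ p c = v

section Descendants

variable {n : ℕ} {r : Fin n} {p : Fin n → Fin n} {D : Fin n → ℕ}

theorem mem_descendants {v x : Fin n} :
    x ∈ descendants p D v ↔ D v ≤ D x ∧ p^[D x - D v] x = v := by
  simp [descendants]

theorem mem_children {v c : Fin n} : c ∈ children r p v ↔ c ≠ r ∧ p c = v := by
  simp [children]

theorem IsRootedTree.descendants_root (hT : IsRootedTree r p D) :
    descendants p D r = Finset.univ := by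
  refine Finset.eq_univ_iff_forall.mpr fun x => mem_descendants.mpr ?_
  have h := hT.depth_iterate x (D x) le_rfl
  rw [hT.depth_root]
  exact ⟨Nat.zero_le _, hT.eq_root (by rw [Nat.sub_zero, h, Nat.sub_self])⟩

/-- The aggregation rule at `v`: its own data plus the sums received from its children. Disjointness
of the parts is what `Holds.add` requires. -/
theorem IsRootedTree.descendants_eq (hT : IsRootedTree r p D) (v : Fin n) :
    descendants p D v = {v} ∪ (children r p v).biUnion (descendants p D) := by
  ext x
  simp only [Finset.mem_union, Finset.mem_singleton, Finset.mem_biUnion, mem_descendants,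
    mem_children]
  constructor
  · rintro ⟨h1, h2⟩
    rcases h1.eq_or_lt with h | h
    · left
      rwa [h, Nat.sub_self] at h2
    · right
      obtain ⟨k, hk⟩ := Nat.exists_eq_add_of_lt h
      have hk' : D x - D v = k + 1 := by omega
      rw [hk', Function.iterate_succ_apply'] at h2
      have h3 := hT.depth_iterate x k (by omega)
      refine ⟨p^[k] x, ⟨fun h => ?_, h2⟩, by omega, ?_⟩
      · rw [h, hT.depth_root] at h3
        omega
      · rw [h3]
        congr 1
        omega
  · rintro (rfl | ⟨c, ⟨hc, rfl⟩, h1, h2⟩)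
    · simp
    · have h3 := hT.depth_parent c hc
      refine ⟨by omega, ?_⟩
      rw [show D x - D (p c) = (D x - D c) + 1 by omega, Function.iterate_succ_apply', h2]

theorem IsRootedTree.depth_of_mem_children (hT : IsRootedTree r p D) {v c : Fin n}
    (hc : c ∈ children r p v) : D c = D v + 1 := by
  rw [mem_children] at hc
  rw [hT.depth_parent c hc.1, hc.2]

theorem IsRootedTree.disjoint_descendants (hT : IsRootedTree r p D) {v c c' : Fin n}
    (hc : c ∈ children r p v) (hc' : c' ∈ children r p v) (hne : c ≠ c') :
    Disjoint (descendants p D c) (descendants p D c') := by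
  rw [Finset.disjoint_left]
  intro x hx hx'
  rw [mem_descendants] at hx hx'
  refine hne ?_
  rw [← hx.2, ← hx'.2, hT.depth_of_mem_children hc, hT.depth_of_mem_children hc']

theorem IsRootedTree.notMem_descendants_child (hT : IsRootedTree r p D) {v c : Fin n}
    (hc : c ∈ children r p v) : v ∉ descendants p D c := by
  rw [mem_descendants, hT.depth_of_mem_children hc]
  omega

end Descendants

open Classical in
/-- Rooted spanning trees of `G` with weights of sum `1`, so that a link of bandwidth `b` carries
trees of total weight at most `2 b / w`. -/
structure TreePacking {n : ℕ} (G : BandwidthGraph n) (r : Fin n) (w : ℝ) where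
  num : ℕ
  parent : ℕ → Fin n → Fin n
  depth : ℕ → Fin n → ℕ
  weight : ℕ → ℝ
  isRootedTree : ∀ j < num, IsRootedTree r (parent j) (depth j)
  bw_pos : ∀ j < num, ∀ u v, TreeEdge r (parent j) u v → 0 < G.bw u v
  weight_nonneg : ∀ j < num, 0 ≤ weight j
  sum_weight : ∑ j ∈ Finset.range num, weight j = 1
  load_le : ∀ u v, w * ∑ j ∈ Finset.range num, (if TreeEdge r (parent j) u v then weight j else 0) ≤
        2 * G.bw u v

namespace TreePacking

variable {n : ℕ} {G : BandwidthGraph n} {r : Fin n} {w : ℝ} (P : TreePacking G r w) (ℓ : ℝ)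

/-- The total weight of the first `j` trees. -/
def cum (j : ℕ) : ℝ := ∑ i ∈ Finset.range j, P.weight i

open Classical in
/-- The total weight of those of the first `j` trees that use the edge `{u, v}`. -/
noncomputable def load (j : ℕ) (u v : Fin n) : ℝ :=
  ∑ i ∈ Finset.range j, if TreeEdge r (P.parent i) u v then P.weight i else 0

/-- The duration of a round, in which every link sends its share of a block of length `ℓ`. -/
noncomputable def round (_P : TreePacking G r w) (ℓ : ℝ) : ℝ := 2 * ℓ / w

/-- The time at which the link from `u` to `v` starts to send the data of tree `j` in round `R`. -/
noncomputable def slot (R j : ℕ) (u v : Fin n) : ℝ := R * P.round ℓ + ℓ * P.load j u v / G.bw u v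

/-- The transmission in which `v` sends the partial sum over its descendants to its parent, for the
share of tree `j` of block `m`. -/
noncomputable def up (m j : ℕ) (v : Fin n) : Packet n where
  src := v
  dst := P.parent j v
  lo := ℓ * (m + P.cum j)
  hi := ℓ * (m + P.cum (j + 1))
  start := P.slot ℓ (m + (n - P.depth j v)) j v (P.parent j v)
  agg := descendants (P.parent j) (P.depth j) v

/-- The transmission in which `v` receives the complete sum from its parent, for the share of tree
`j` of block `m`. -/
noncomputable def down (m j : ℕ) (v : Fin n) : Packet n where
  src := P.parent j v
  dst := v
  lo := ℓ * (m + P.cum j)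
  hi := ℓ * (m + P.cum (j + 1))
  start := P.slot ℓ (2 * n + m + P.depth j (P.parent j v)) j (P.parent j v) v
  agg := Finset.univ

/-- The pipelined AllReduce along the trees of the packing, for `n` blocks of length `ℓ`. -/
def schedule : Set (Packet n) :=
  {q | ∃ m < n, ∃ j < P.num, ∃ v ≠ r, 0 < P.weight j ∧ (q = P.up ℓ m j v ∨ q = P.down ℓ m j v)}

theorem load_succ {j : ℕ} {u v : Fin n} (h : TreeEdge r (P.parent j) u v) :
    P.load (j + 1) u v = P.load j u v + P.weight j := by
  simp [load, Finset.sum_range_succ, h]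

theorem cum_succ (j : ℕ) : P.cum (j + 1) = P.cum j + P.weight j :=
  Finset.sum_range_succ _ _

theorem load_mono {i j : ℕ} (hij : i ≤ j) (hj : j ≤ P.num) (u v : Fin n) :
    P.load i u v ≤ P.load j u v := by
  classical
  refine Finset.sum_le_sum_of_subset_of_nonneg (Finset.range_mono hij) fun k hk _ => ?_
  have := P.weight_nonneg k ((Finset.mem_range.mp hk).trans_le hj)
  split_ifs <;> linarith

theorem cum_mono {i j : ℕ} (hij : i ≤ j) (hj : j ≤ P.num) : P.cum i ≤ P.cum j :=
  Finset.sum_le_sum_of_subset_of_nonneg (Finset.range_mono hij) fun k hk _ =>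
    P.weight_nonneg k ((Finset.mem_range.mp hk).trans_le hj)

variable {P ℓ}

theorem round_nonneg (hw : 0 < w) (hℓ : 0 < ℓ) : 0 ≤ P.round ℓ := by
  unfold round; positivity

theorem le_slot (hℓ : 0 < ℓ) {j : ℕ} (hj : j < P.num) (R : ℕ) (u v : Fin n) :
    R * P.round ℓ ≤ P.slot ℓ R j u v := by
  have h1 := P.load_mono (Nat.zero_le j) hj.le u v
  have h2 : P.load 0 u v = 0 := by simp [load]
  have h3 := G.bw_nonneg u v
  rw [h2] at h1
  unfold slot
  have : 0 ≤ ℓ * P.load j u v / G.bw u v := by positivity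
  linarith

/-- The reason for the length `2ℓ / w` of a round: the trees on a link of bandwidth `b` have total
weight at most `2b / w`, so all its data of one round fit. -/
theorem slot_succ_le (hw : 0 < w) (hℓ : 0 < ℓ) {j : ℕ} (hj : j < P.num) (R : ℕ) {u v : Fin n}
    (h : TreeEdge r (P.parent j) u v) :
    P.slot ℓ R (j + 1) u v ≤ ((R + 1 : ℕ) : ℝ) * P.round ℓ := by
  have hb := P.bw_pos j hj u v h
  have h1 := P.load_mono (i := j + 1) hj le_rfl u v
  have h2 : w * P.load P.num u v ≤ 2 * G.bw u v := P.load_le u v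
  have h3 : ℓ * P.load (j + 1) u v / G.bw u v ≤ 2 * ℓ / w := by
    rw [div_le_div_iff₀ hb hw]
    have : w * P.load (j + 1) u v ≤ 2 * G.bw u v :=
      (mul_le_mul_of_nonneg_left h1 hw.le).trans h2
    nlinarith
  unfold slot
  push_cast
  rw [add_mul, one_mul]
  unfold round
  linarith

theorem slot_le_slot (hℓ : 0 < ℓ) {i j : ℕ} (hij : i ≤ j) (hj : j ≤ P.num) (R : ℕ) (u v : Fin n) :
    P.slot ℓ R i u v ≤ P.slot ℓ R j u v := by
  have h1 := P.load_mono hij hj u v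
  have h2 := G.bw_nonneg u v
  unfold slot
  gcongr

theorem slot_add_length {j : ℕ} (R m : ℕ) {u v : Fin n} (h : TreeEdge r (P.parent j) u v) :
    P.slot ℓ R j u v + (ℓ * (m + P.cum (j + 1)) - ℓ * (m + P.cum j)) / G.bw u v =
      P.slot ℓ R (j + 1) u v := by
  simp only [slot, P.load_succ h, P.cum_succ]
  ring

theorem slots_disjoint (hw : 0 < w) (hℓ : 0 < ℓ) {R R' j j' : ℕ} {u v : Fin n} (hj : j < P.num)
    (hj' : j' < P.num) (h : TreeEdge r (P.parent j) u v) (h' : TreeEdge r (P.parent j') u v)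
    (hne : R ≠ R' ∨ j ≠ j') :
    P.slot ℓ R (j + 1) u v ≤ P.slot ℓ R' j' u v ∨ P.slot ℓ R' (j' + 1) u v ≤ P.slot ℓ R j u v := by
  have key : ∀ {R R' j j' : ℕ}, j < P.num → j' < P.num → TreeEdge r (P.parent j) u v → R < R' →
      P.slot ℓ R (j + 1) u v ≤ P.slot ℓ R' j' u v := by
    intro R R' j j' hj hj' h hR
    refine (slot_succ_le hw hℓ hj R h).trans (le_trans ?_ (le_slot hℓ hj' R' u v))
    have : ((R + 1 : ℕ) : ℝ) ≤ (R' : ℝ) := by exact_mod_cast hR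
    exact mul_le_mul_of_nonneg_right this (round_nonneg hw hℓ)
  rcases lt_trichotomy R R' with hR | rfl | hR
  · exact Or.inl (key hj hj' h hR)
  · rcases lt_or_gt_of_ne (hne.resolve_left fun h => h rfl) with hlt | hlt
    · exact Or.inl (slot_le_slot hℓ hlt hj'.le R u v)
    · exact Or.inr (slot_le_slot hℓ hlt hj.le R u v)
  · exact Or.inr (key hj' hj h' hR)

theorem treeEdge_up {j : ℕ} {v : Fin n} (hv : v ≠ r) :
    TreeEdge r (P.parent j) v (P.parent j v) := Or.inl ⟨hv, rfl⟩

theorem finish_up {j : ℕ} {v : Fin n} (hv : v ≠ r) (m : ℕ) :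
    (P.up ℓ m j v).finish G =
      P.slot ℓ (m + (n - P.depth j v)) (j + 1) v (P.parent j v) :=
  slot_add_length _ m (treeEdge_up hv)

theorem finish_down {j : ℕ} {v : Fin n} (hv : v ≠ r) (m : ℕ) :
    (P.down ℓ m j v).finish G =
      P.slot ℓ (2 * n + m + P.depth j (P.parent j v)) (j + 1) (P.parent j v) v :=
  slot_add_length _ m (treeEdge_up hv).symm

/-- The packet that is sent for tree `j` in round `R` from `u` to `v`. -/
noncomputable def slotPacket (P : TreePacking G r w) (ℓ : ℝ) (R j : ℕ) (u v : Fin n) : Packet n :=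
  if R < 2 * n then P.up ℓ (R + P.depth j u - n) j u
  else P.down ℓ (R - 2 * n - P.depth j u) j v

/-- Upward packets occupy rounds below `2n` and downward packets later ones, so round, tree and
directed link determine the packet. Hence distinct packets on a link have distinct slots. -/
theorem exists_slot_of_mem_schedule {q : Packet n} (hq : q ∈ P.schedule ℓ) :
    ∃ R j, R < 4 * n ∧ j < P.num ∧ TreeEdge r (P.parent j) q.src q.dst ∧
      q.start = P.slot ℓ R j q.src q.dst ∧ q.finish G = P.slot ℓ R (j + 1) q.src q.dst ∧
      q = P.slotPacket ℓ R j q.src q.dst := by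
  obtain ⟨m, hm, j, hj, v, hv, -, rfl | rfl⟩ := hq
  · have h1 := (P.isRootedTree j hj).depth_lt v
    refine ⟨m + (n - P.depth j v), j, by omega, hj, treeEdge_up hv, rfl, finish_up hv m, ?_⟩
    rw [slotPacket, if_pos (by omega)]
    change _ = P.up ℓ (m + (n - P.depth j v) + P.depth j v - n) j v
    congr 1
    omega
  · have h1 := (P.isRootedTree j hj).depth_lt (P.parent j v)
    refine ⟨2 * n + m + P.depth j (P.parent j v), j, by omega, hj, (treeEdge_up hv).symm, rfl,
      finish_down hv m, ?_⟩
    rw [slotPacket, if_neg (by omega)]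
    change _ = P.down ℓ (2 * n + m + P.depth j (P.parent j v) - 2 * n -
      P.depth j (P.parent j v)) j v
    congr 1
    omega

theorem schedule_finite : (P.schedule ℓ).Finite := by
  have h : (⋃ m ∈ Finset.range n, ⋃ j ∈ Finset.range P.num, ⋃ v : Fin n,
      ({P.up ℓ m j v, P.down ℓ m j v} : Set (Packet n))).Finite := by
    refine Set.Finite.biUnion (Finset.finite_toSet _) fun m _ => ?_
    refine Set.Finite.biUnion (Finset.finite_toSet _) fun j _ => ?_
    exact Set.finite_iUnion fun v => Set.toFinite _
  refine h.subset ?_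
  rintro q ⟨m, hm, j, hj, v, -, -, hq⟩
  simp only [Set.mem_iUnion, Finset.mem_range, exists_prop]
  exact ⟨m, hm, j, hj, v, hq⟩

/-- A child lies one level deeper and sends one round earlier, so its packet has arrived when the
round of `v` begins. No induction on depth is needed: `Holds.recv` only asks that the packet be
scheduled, and causality is checked separately with this same lemma. -/
theorem holds_descendants (hw : 0 < w) (hℓ : 0 < ℓ) {m j : ℕ} (hm : m < n) (hj : j < P.num) {x : ℝ}
    (hlo : ℓ * (m + P.cum j) ≤ x) (hhi : x < ℓ * (m + P.cum (j + 1))) (v : Fin n) {t : ℝ}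
    (ht : ((m + (n - P.depth j v) : ℕ) : ℝ) * P.round ℓ ≤ t) :
    Holds G (P.schedule ℓ) t v x (descendants (P.parent j) (P.depth j) v) := by
  classical
  have hT := P.isRootedTree j hj
  -- Trees of weight zero send no packets, as packets must be nonempty; a share that contains `x`
  -- has positive weight.
  have hpos : 0 < P.weight j := by
    have := hlo.trans_lt hhi
    rw [P.cum_succ] at this
    nlinarith
  rw [hT.descendants_eq v]
  suffices h : ∀ C ⊆ children r (P.parent j) v, Holds G (P.schedule ℓ) t v x
      ({v} ∪ C.biUnion (descendants (P.parent j) (P.depth j))) from h _ subset_rfl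
  intro C
  induction C using Finset.induction_on with
  | empty => intro; simpa using Holds.own
  | insert c C hcC ih =>
    intro hsub
    have hc := hsub (Finset.mem_insert_self c C)
    have hC : C ⊆ children r (P.parent j) v := (Finset.subset_insert c C).trans hsub
    have hcr := mem_children.mp hc
    have hrecv : Holds G (P.schedule ℓ) t v x (descendants (P.parent j) (P.depth j) c) := by
      refine Holds.recv (P.up ℓ m j c) ⟨m, hm, j, hj, c, hcr.1, hpos, Or.inl rfl⟩ hcr.2 ?_ hlo hhi
      rw [finish_up hcr.1]
      refine (slot_succ_le hw hℓ hj _ (treeEdge_up hcr.1)).trans (le_trans (le_of_eq ?_) ht)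
      have h1 := hT.depth_of_mem_children hc
      have h2 := hT.depth_lt c
      congr 2
      omega
    have := Holds.add (ih hC) hrecv (by
      rw [Finset.disjoint_union_left, Finset.disjoint_singleton_left]
      refine ⟨hT.notMem_descendants_child hc, ?_⟩
      rw [Finset.disjoint_biUnion_left]
      exact fun c' hc' => hT.disjoint_descendants (hC hc') hc fun h => hcC (h ▸ hc'))
    convert this using 1
    rw [Finset.biUnion_insert, Finset.union_assoc, Finset.union_comm (descendants _ _ c)]

theorem holds_univ (hw : 0 < w) (hℓ : 0 < ℓ) {m j : ℕ} (hm : m < n) (hj : j < P.num) {x : ℝ}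
    (hlo : ℓ * (m + P.cum j) ≤ x) (hhi : x < ℓ * (m + P.cum (j + 1))) (v : Fin n) {t : ℝ}
    (ht : ((2 * n + m + P.depth j v : ℕ) : ℝ) * P.round ℓ ≤ t) :
    Holds G (P.schedule ℓ) t v x Finset.univ := by
  have hT := P.isRootedTree j hj
  have hpos : 0 < P.weight j := by
    have := hlo.trans_lt hhi
    rw [P.cum_succ] at this
    nlinarith
  by_cases hv : v = r
  · subst hv
    rw [← hT.descendants_root]
    refine holds_descendants hw hℓ hm hj hlo hhi v (le_trans ?_ ht)
    refine mul_le_mul_of_nonneg_right ?_ (round_nonneg hw hℓ)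
    rw [hT.depth_root]
    exact_mod_cast (by omega : m + (n - 0) ≤ 2 * n + m + 0)
  · refine Holds.recv (P.down ℓ m j v) ⟨m, hm, j, hj, v, hv, hpos, Or.inr rfl⟩ rfl ?_ hlo hhi
    rw [finish_down hv]
    refine (slot_succ_le hw hℓ hj _ (treeEdge_up hv).symm).trans (le_trans (le_of_eq ?_) ht)
    rw [hT.depth_parent v hv, add_assoc]

theorem exists_block (hℓ : 0 < ℓ) {x : ℝ} (hx : 0 ≤ x) (hxn : x < n * ℓ) :
    ∃ m < n, ∃ j < P.num, ℓ * (m + P.cum j) ≤ x ∧ x < ℓ * (m + P.cum (j + 1)) := by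
  classical
  have hm0 : (⌊x / ℓ⌋₊ : ℝ) ≤ x / ℓ := Nat.floor_le (by positivity)
  have hm1 : x / ℓ < ⌊x / ℓ⌋₊ + 1 := Nat.lt_floor_add_one _
  set m := ⌊x / ℓ⌋₊ with hm
  -- The tree responsible for `x` is found from the first cumulative weight exceeding the fractional
  -- part of `x / ℓ`.
  have hex : ∃ k, x / ℓ - m < P.cum k := ⟨P.num, by
    rw [show P.cum P.num = 1 from P.sum_weight]; linarith⟩
  have hk := Nat.find_spec hex
  have hkmin := fun i => Nat.find_min hex (m := i)
  have hkle : Nat.find hex ≤ P.num := Nat.find_min' hex (by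
    rw [show P.cum P.num = 1 from P.sum_weight]; linarith)
  obtain ⟨j, hj⟩ : ∃ j, Nat.find hex = j + 1 := by
    refine Nat.exists_eq_succ_of_ne_zero fun h => ?_
    rw [h] at hk
    simp only [cum, Finset.range_zero, Finset.sum_empty] at hk
    linarith
  have hj0 := hkmin j (by omega)
  rw [hj] at hk hkle
  refine ⟨m, ?_, j, hkle, ?_, ?_⟩
  · have : (m : ℝ) < n := hm0.trans_lt (by rwa [div_lt_iff₀ hℓ])
    exact_mod_cast this
  · rw [not_lt] at hj0
    rw [mul_comm, ← le_div_iff₀ hℓ]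
    linarith
  · rw [mul_comm, ← div_lt_iff₀ hℓ]
    linarith

theorem isAllReduce (P : TreePacking G r w) (hw : 0 < w) {d : ℕ} (hd : 0 < d) :
    IsAllReduce G d (P.schedule ((d : ℝ) / n)) (8 * (d / w)) := by
  have hn : 0 < n := r.pos
  have hn' : (0 : ℝ) < n := by exact_mod_cast hn
  have hd' : (0 : ℝ) < d := by exact_mod_cast hd
  set ℓ : ℝ := d / n with hℓdef
  have hℓ : 0 < ℓ := by positivity
  have hnℓ : n * ℓ = d := by rw [hℓdef]; field_simp
  have hT : ((4 * n : ℕ) : ℝ) * P.round ℓ = 8 * (d / w) := by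
    rw [← hnℓ]; unfold round; push_cast; ring
  have hround := round_nonneg (P := P) hw hℓ
  refine ⟨by positivity, schedule_finite, ?_, ?_, ?_, ?_, ?_, ?_⟩
  · intro q hq
    obtain ⟨R, j, -, hj, hedge, -⟩ := exists_slot_of_mem_schedule hq
    have hT := P.isRootedTree j hj
    rw [toSimpleGraph, SimpleGraph.fromRel_adj]
    refine ⟨?_, Or.inl (P.bw_pos j hj _ _ hedge)⟩
    rcases hedge with ⟨h1, h2⟩ | ⟨h1, h2⟩ <;> intro h <;> have := hT.depth_parent _ h1 <;>
      rw [h2, h] at this <;> omega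
  · rintro q ⟨m, hm, j, hj, v, hv, hpos, hq⟩
    have h1 : 0 ≤ P.cum j := by
      have := P.cum_mono (Nat.zero_le j) hj.le
      simpa [cum] using this
    have h2 : P.cum (j + 1) ≤ 1 := (P.cum_mono hj le_rfl).trans_eq P.sum_weight
    have h3 : (m : ℝ) + 1 ≤ n := by exact_mod_cast hm
    have hlo : q.lo = ℓ * (m + P.cum j) := by rcases hq with rfl | rfl <;> rfl
    have hhi : q.hi = ℓ * (m + P.cum (j + 1)) := by rcases hq with rfl | rfl <;> rfl
    rw [hlo, hhi]
    refine ⟨by positivity, ?_, ?_⟩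
    · rw [P.cum_succ]
      exact mul_lt_mul_of_pos_left (by linarith) hℓ
    · rw [← hnℓ, mul_comm]
      exact mul_le_mul_of_nonneg_right (by linarith) hℓ.le
  · intro q hq
    obtain ⟨R, j, hR, hj, hedge, hstart, hfin, -⟩ := exists_slot_of_mem_schedule hq
    rw [hstart, hfin]
    refine ⟨le_trans (by positivity) (le_slot hℓ hj R _ _), ?_⟩
    refine (slot_succ_le hw hℓ hj R hedge).trans ?_
    rw [← hT]
    have : ((R + 1 : ℕ) : ℝ) ≤ ((4 * n : ℕ) : ℝ) := by exact_mod_cast hR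
    exact mul_le_mul_of_nonneg_right this hround
  · rintro q ⟨m, hm, j, hj, v, hv, hpos, rfl | rfl⟩ x hlo hhi
    · exact holds_descendants hw hℓ hm hj hlo hhi v (le_slot hℓ hj _ _ _)
    · exact holds_univ hw hℓ hm hj hlo hhi (P.parent j v) (le_slot hℓ hj _ _ _)
  · intro q hq q' hq' hne hsrc hdst
    obtain ⟨R, j, -, hj, hedge, hstart, hfin, heq⟩ := exists_slot_of_mem_schedule hq
    obtain ⟨R', j', -, hj', hedge', hstart', hfin', heq'⟩ := exists_slot_of_mem_schedule hq'
    rw [← hsrc, ← hdst] at hedge' hstart' hfin' heq'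
    rw [hstart, hfin, hstart', hfin']
    refine slots_disjoint hw hℓ hj hj' hedge hedge' ?_
    by_contra! h
    rw [← h.1, ← h.2, ← heq] at heq'
    exact hne heq'.symm
  · intro v x hx0 hxd
    obtain ⟨m, hm, j, hj, hlo, hhi⟩ := exists_block (P := P) hℓ hx0 (by rwa [hnℓ])
    refine holds_univ hw hℓ hm hj hlo hhi v ?_
    rw [← hT]
    have h1 := (P.isRootedTree j hj).depth_lt v
    refine mul_le_mul_of_nonneg_right ?_ hround
    exact_mod_cast (by omega : 2 * n + m + P.depth j v ≤ 4 * n)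

end TreePacking

theorem exists_isAllReduce {n : ℕ} (G : BandwidthGraph n) (d : ℕ) :
    ∃ S, IsAllReduce G d S (8 * ((d : ℝ≥0∞) / G.minCut).toReal) := by
  rcases Nat.eq_zero_or_pos d with rfl | hd
  · refine ⟨∅, ⟨by positivity, Set.finite_empty, by simp, by simp, by simp, by simp, by simp, ?_⟩⟩
    intro v u h0 h1
    rw [Nat.cast_zero] at h1
    exact (h0.not_gt h1).elim
  have : Nonempty (Fin n) := G.connected.nonempty
  obtain ⟨r⟩ := this
  by_cases hn : 2 ≤ n
  · obtain ⟨w, hw0, hw, hmin⟩ := G.exists_minCut_eq hn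
    obtain ⟨N, p, D, μ, h1, h2, h3, h4, h5⟩ := G.exists_tree_packing hw0 hmin r
    let P : TreePacking G r w := ⟨N, p, D, μ, h1, h2, h3, h4, h5⟩
    refine ⟨P.schedule ((d : ℝ) / n), ?_⟩
    rw [hw, ENNReal.toReal_div, ENNReal.toReal_natCast, ENNReal.toReal_ofReal hw0.le]
    exact P.isAllReduce hw0 hd
  · have hr := r.pos
    have hn1 : n = 1 := by omega
    subst hn1
    -- A single worker already holds the full sum, so no packet is needed.
    refine ⟨∅, ⟨by positivity, Set.finite_empty, by simp, by simp, by simp, by simp, by simp, ?_⟩⟩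
    intro v u _ _
    have : (Finset.univ : Finset (Fin 1)) = {v} := by
      exact (Finset.eq_univ_of_card _ (by simp)).symm
    rw [this]
    exact Holds.own

end BandwidthGraph

/-! ### Descent for smooth functions -/

section Smooth

variable {d : ℕ} {L : ℝ} {φ : Pt d → ℝ}

/-- Along the segment, `ψ` has derivative `⟪∇φ(x + tv) - ∇φ(x), v⟫ - Lt‖v‖²`, which is nonpositive
by Cauchy–Schwarz and the Lipschitz bound. -/
theorem IsSmooth.le_add_inner_add_sq (h : IsSmooth L φ) (x v : Pt d) :
    φ (x + v) ≤ φ x + inner ℝ (gradient φ x) v + L / 2 * ‖v‖ ^ 2 := by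
  let ψ : ℝ → ℝ := fun t => φ (x + t • v) - t * inner ℝ (gradient φ x) v - L / 2 * t ^ 2 * ‖v‖ ^ 2
  have hderiv : ∀ t, HasDerivAt ψ (inner ℝ (gradient φ (x + t • v)) v - inner ℝ (gradient φ x) v -
      L * t * ‖v‖ ^ 2) t := by
    intro t
    have h1 : HasDerivAt (fun s : ℝ => x + s • v) v t := by
      simpa using ((hasDerivAt_id t).smul_const v).const_add x
    have h2 := (h.1 (x + t • v)).hasFDerivAt.comp_hasDerivAt t h1
    rw [← inner_gradient_left] at h2
    have h3 := (hasDerivAt_id t).mul_const (inner ℝ (gradient φ x) v)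
    have h4 := (((hasDerivAt_id t).pow 2).const_mul (L / 2)).mul_const (‖v‖ ^ 2)
    convert! (h2.sub h3).sub h4 using 1
    simp only [Nat.cast_ofNat, id, Nat.reduceSub, pow_one]
    ring
  have hanti : AntitoneOn ψ (Set.Icc 0 1) := by
    refine antitoneOn_of_deriv_nonpos (convex_Icc 0 1)
      (fun t _ => (hderiv t).continuousAt.continuousWithinAt)
      (fun t _ => (hderiv t).differentiableAt.differentiableWithinAt) fun t ht => ?_
    rw [interior_Icc] at ht
    rw [(hderiv t).deriv, ← inner_sub_left]
    have h1 := real_inner_le_norm (gradient φ (x + t • v) - gradient φ x) v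
    have h2 := h.2 (x + t • v) x
    rw [add_sub_cancel_left, norm_smul, Real.norm_of_nonneg ht.1.le] at h2
    nlinarith [mul_le_mul_of_nonneg_right h2 (norm_nonneg v)]
  have := hanti (Set.left_mem_Icc.mpr zero_le_one) (Set.right_mem_Icc.mpr zero_le_one) zero_le_one
  simp only [ψ, one_smul, zero_smul, add_zero] at this
  linarith

theorem IsSmooth.continuous_gradient (hL : 0 < L) (h : IsSmooth L φ) : Continuous (gradient φ) := by
  have : LipschitzWith ⟨L, hL.le⟩ (gradient φ) := LipschitzWith.of_dist_le_mul fun x y => by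
    rw [dist_eq_norm, dist_eq_norm]
    exact h.2 x y
  exact this.continuous

/-- Expanding the descent lemma at step `1/(2L)`: the coefficient of `‖∇φ‖²` is `-1/(2L) + 1/(8L)`.
The term linear in the error `e` is kept because it vanishes in expectation. -/
theorem IsSmooth.gradient_step_le (hL : 0 < L) (h : IsSmooth L φ) (x e : Pt d) :
    φ (x - (1 / (2 * L)) • (gradient φ x + e)) + 3 / (8 * L) * ‖gradient φ x‖ ^ 2 ≤
      φ x - 1 / (4 * L) * inner ℝ (gradient φ x) e + 1 / (8 * L) * ‖e‖ ^ 2 := by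
  have h1 := h.le_add_inner_add_sq x (-((1 / (2 * L)) • (gradient φ x + e)))
  rw [← sub_eq_add_neg, inner_neg_right, inner_smul_right, norm_neg, norm_smul, mul_pow,
    norm_add_sq_real, inner_add_right, real_inner_self_eq_norm_sq, Real.norm_eq_abs, sq_abs] at h1
  refine (add_le_add_left h1 _).trans (le_of_eq ?_)
  field_simp
  ring

end Smooth

/-! ### Second moments of independent sums -/

section SumIndep

variable {Ω ι E : Type*} [MeasurableSpace Ω] {P : Measure Ω} [NormedAddCommGroup E]
  [InnerProductSpace ℝ E]

theorem integrable_inner_of_sq {X Y : Ω → E} (hX : Integrable X P) (hY : Integrable Y P)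
    (hX2 : Integrable (fun ω => ‖X ω‖ ^ 2) P) (hY2 : Integrable (fun ω => ‖Y ω‖ ^ 2) P) :
    Integrable (fun ω => inner ℝ (X ω) (Y ω)) P := by
  refine (hX2.add hY2).mono' (hX.1.inner hY.1) (Filter.Eventually.of_forall fun ω => ?_)
  have := norm_inner_le_norm (𝕜 := ℝ) (X ω) (Y ω)
  simp only [Pi.add_apply]
  nlinarith [sq_nonneg (‖X ω‖ - ‖Y ω‖), sq_nonneg (‖X ω‖ + ‖Y ω‖)]

/-- The second moment of a sum of pairwise independent centered vectors is the sum of the second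
moments. -/
theorem integral_norm_sum_sq_eq [CompleteSpace E] [MeasurableSpace E] [BorelSpace E] {s : Finset ι} {Z : ι → Ω → E}
    (hint : ∀ q ∈ s, Integrable (Z q) P) (hsq : ∀ q ∈ s, Integrable (fun ω => ‖Z q ω‖ ^ 2) P)
    (hzero : ∀ q ∈ s, ∫ ω, Z q ω ∂P = 0)
    (hindep : ∀ q ∈ s, ∀ q' ∈ s, q ≠ q' → IndepFun (Z q) (Z q') P) :
    Integrable (fun ω => ‖∑ q ∈ s, Z q ω‖ ^ 2) P ∧
      ∫ ω, ‖∑ q ∈ s, Z q ω‖ ^ 2 ∂P = ∑ q ∈ s, ∫ ω, ‖Z q ω‖ ^ 2 ∂P := by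
  have hexp : (fun ω => ‖∑ q ∈ s, Z q ω‖ ^ 2) =
      fun ω => ∑ q ∈ s, ∑ q' ∈ s, inner ℝ (Z q ω) (Z q' ω) := by
    funext ω
    rw [← real_inner_self_eq_norm_sq, sum_inner]
    simp only [inner_sum]
  have hinn : ∀ q ∈ s, ∀ q' ∈ s, Integrable (fun ω => inner ℝ (Z q ω) (Z q' ω)) P :=
    fun q hq q' hq' => integrable_inner_of_sq (hint q hq) (hint q' hq') (hsq q hq) (hsq q' hq')
  rw [hexp]
  refine ⟨integrable_finsetSum _ fun q hq => integrable_finsetSum _ (hinn q hq), ?_⟩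
  rw [integral_finsetSum _ fun q hq => integrable_finsetSum _ (hinn q hq)]
  refine Finset.sum_congr rfl fun q hq => ?_
  rw [integral_finsetSum _ (hinn q hq), Finset.sum_eq_single q]
  · simp only [real_inner_self_eq_norm_sq]
  · intro q' hq' hne
    have : ∫ ω, inner ℝ (Z q ω) (Z q' ω) ∂P = inner ℝ (∫ ω, Z q ω ∂P) (∫ ω, Z q' ω ∂P) :=
      (hindep q hq q' hq' hne.symm).integral_bilin (hint q hq) (hint q' hq') (innerSL ℝ)
    rw [this, hzero q hq, inner_zero_left]
  · exact fun h => (h hq).elim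

end SumIndep

/-! ### The averaged stochastic gradient -/

section Oracle

variable {n d : ℕ}

/-- The average over the workers of the averages of their stochastic gradients at `x`, for the
samples `ζ`. -/
noncomputable def batchGradient {Ξ : Type*} (B : Fin n → ℕ) (g : Fin n → Pt d → Ξ → Pt d) (x : Pt d)
    (ζ : Fin n → ℕ → Ξ) : Pt d :=
  (1 / (n : ℝ)) • ∑ i, (1 / (B i : ℝ)) • ∑ j ∈ Finset.range (B i), g i x (ζ i j)

theorem leonIterate_succ {Ω Ξ : Type*} (L : ℝ) (B : Fin n → ℕ) (g : Fin n → Pt d → Ξ → Pt d)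
    (x₀ : Pt d) (ξ : ℕ → Fin n → ℕ → Ω → Ξ) (k : ℕ) (ω : Ω) :
    leonIterate L B g x₀ ξ (k + 1) ω = leonIterate L B g x₀ ξ k ω -
      (1 / (2 * L)) • batchGradient B g (leonIterate L B g x₀ ξ k ω) fun i j => ξ k i j ω := by
  simp only [leonIterate, batchGradient, smul_smul]
  rw [mul_one_div]

theorem gradient_meanObjective {f : Fin n → Pt d → ℝ} (hf : ∀ i, Differentiable ℝ (f i))
    (x : Pt d) : gradient (meanObjective f) x = (1 / (n : ℝ)) • ∑ i, gradient (f i) x := by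
  refine HasGradientAt.gradient ?_
  rw [hasGradientAt_iff_hasFDerivAt, map_smul, map_sum]
  have h1 : ∀ i ∈ Finset.univ, HasFDerivAt (f i)
      (InnerProductSpace.toDual ℝ (Pt d) (gradient (f i) x)) x :=
    fun i _ => (hf i x).hasGradientAt.hasFDerivAt
  have h2 := (HasFDerivAt.fun_sum h1).const_smul (1 / (n : ℝ))
  exact h2

variable {Ω Ξ : Type*} [MeasurableSpace Ω] [MeasurableSpace Ξ]

theorem measurable_batchGradient {B : Fin n → ℕ} {g : Fin n → Pt d → Ξ → Pt d}
    (hg : ∀ i, Measurable (Function.uncurry (g i))) :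
    Measurable fun z : Pt d × (Fin n → ℕ → Ξ) => batchGradient B g z.1 z.2 := by
  unfold batchGradient
  have h : ∀ i j, Measurable fun z : Pt d × (Fin n → ℕ → Ξ) => g i z.1 (z.2 i j) := fun i j =>
    (hg i).comp (measurable_fst.prodMk
      ((measurable_pi_apply j).comp ((measurable_pi_apply i).comp measurable_snd)))
  fun_prop

/-- Only samples from before iteration `k` are assumed measurable, so that the lemma also applies to
the σ-algebra generated by those samples. This yields independence of the iterate from the fresh
samples. -/
theorem measurable_leonIterate {L : ℝ} {B : Fin n → ℕ} {g : Fin n → Pt d → Ξ → Pt d} {x₀ : Pt d}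
    {ξ : ℕ → Fin n → ℕ → Ω → Ξ} (hg : ∀ i, Measurable (Function.uncurry (g i))) (k : ℕ)
    (hξ : ∀ k' < k, ∀ i j, Measurable (ξ k' i j)) : Measurable (leonIterate L B g x₀ ξ k) := by
  induction k with
  | zero => exact measurable_const
  | succ k ih =>
    have h1 := ih fun k' hk' => hξ k' (by omega)
    have h2 : Measurable fun ω i j => ξ k i j ω :=
      measurable_pi_lambda _ fun i => measurable_pi_lambda _ fun j => hξ k (by omega) i j
    have h3 := h1.sub (((measurable_batchGradient (B := B) hg).comp (h1.prodMk h2)).const_smul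
      (1 / (2 * L)))
    rw [funext (leonIterate_succ L B g x₀ ξ k)]
    exact h3

variable {P : Measure Ω} {D : Fin n → Measure Ξ} {ξ : ℕ → Fin n → ℕ → Ω → Ξ}

theorem IsSampling.indepFun_leonIterate (hS : IsSampling P D ξ) {L : ℝ} {B : Fin n → ℕ}
    {g : Fin n → Pt d → Ξ → Pt d} {x₀ : Pt d} (hg : ∀ i, Measurable (Function.uncurry (g i)))
    (k : ℕ) : IndepFun (leonIterate L B g x₀ ξ k) (fun ω i j => ξ k i j ω) P := by
  let m : ℕ × Fin n × ℕ → MeasurableSpace Ω := fun q =>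
    MeasurableSpace.comap (ξ q.1 q.2.1 q.2.2) inferInstance
  have hm : ∀ q, m q ≤ _ := fun q => (hS.measurable q.1 q.2.1 q.2.2).comap_le
  have hdisj : Disjoint {q : ℕ × Fin n × ℕ | q.1 < k} {q | q.1 = k} :=
    Set.disjoint_left.mpr fun q h1 h2 => (ne_of_lt h1) h2
  have hind := indep_iSup_of_disjoint hm hS.indep.iIndep hdisj
  have hmeas : ∀ (A : Set (ℕ × Fin n × ℕ)) (q : ℕ × Fin n × ℕ), q ∈ A →
      Measurable[⨆ q ∈ A, m q] (ξ q.1 q.2.1 q.2.2) := by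
    intro A q hq
    exact Measurable.mono (comap_measurable _) (le_iSup₂_of_le q hq le_rfl) le_rfl
  rw [IndepFun_iff_Indep]
  refine indep_of_indep_of_le_left (indep_of_indep_of_le_right hind ?_) ?_
  · refine Measurable.comap_le ?_
    refine @measurable_pi_lambda _ _ _ (_) _ _ fun i => @measurable_pi_lambda _ _ _ (_) _ _ fun j => ?_
    exact hmeas {q | q.1 = k} (k, i, j) rfl
  · refine Measurable.comap_le ?_
    exact @measurable_leonIterate n d Ω Ξ (_) _ L B g x₀ ξ hg k fun k' hk' i j =>
      hmeas {q | q.1 < k} (k', i, j) hk'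

/-- Fubini in place of conditional expectation: the current iterate may be frozen while averaging
over the new samples. -/
theorem lintegral_prod_eq_of_indepFun {α β : Type*} [MeasurableSpace α] [MeasurableSpace β]
    [IsProbabilityMeasure P] {X : Ω → α} {Y : Ω → β} (hX : Measurable X) (hY : Measurable Y)
    (hXY : IndepFun X Y P) {F : α × β → ℝ≥0∞} (hF : Measurable F) :
    ∫⁻ ω, F (X ω, Y ω) ∂P = ∫⁻ ω, ∫⁻ ω', F (X ω, Y ω') ∂P ∂P := by
  have := Measure.isProbabilityMeasure_map (μ := P) hX.aemeasurable
  have := Measure.isProbabilityMeasure_map (μ := P) hY.aemeasurable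
  rw [← lintegral_map hF (hX.prodMk hY), hXY.map_prod_eq_prod_map_map hX.aemeasurable
    hY.aemeasurable, lintegral_prod _ hF.aemeasurable, lintegral_map hF.lintegral_prod_right' hX]
  refine lintegral_congr fun ω => ?_
  exact lintegral_map (f := fun y => F (X ω, y)) (hF.comp measurable_prodMk_left) hY

/-- The left side equals `σ² / n` times the mean of the `1 / B i`, and the stopping condition bounds
that mean by `nε / σ²` when `σ ≠ 0`. -/
theorem sq_mul_sum_inv_le {n : ℕ} {σ ε : ℝ} (hε : 0 < ε) (hn : 0 < n) {B : Fin n → ℕ}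
    (hB : BatchesSuffice (σ ^ 2 / ε) B) :
    ∑ i, (B i : ℝ) * ((1 / ((n : ℝ) * B i)) ^ 2 * σ ^ 2) ≤ ε := by
  have hn' : (0 : ℝ) < n := by exact_mod_cast hn
  have : NeZero n := ⟨hn.ne'⟩
  have hBpos : ∀ i, (0 : ℝ) < B i := fun i => by exact_mod_cast hB.1 i
  set A := (1 / (n : ℝ)) * ∑ i, 1 / (B i : ℝ) with hA
  have hApos : 0 < A := by
    have : 0 < ∑ i, 1 / (B i : ℝ) := Finset.sum_pos
      (fun i _ => by have := hBpos i; positivity) Finset.univ_nonempty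
    positivity
  have h1 : σ ^ 2 / ε / n ≤ A⁻¹ :=
    le_trans (by gcongr; exact (Nat.le_ceil _).trans (le_max_left _ _)) hB.2
  have h2 : ∑ i, (B i : ℝ) * ((1 / ((n : ℝ) * B i)) ^ 2 * σ ^ 2) = σ ^ 2 / n * A := by
    rw [hA, Finset.mul_sum, Finset.mul_sum]
    refine Finset.sum_congr rfl fun i _ => ?_
    have := (hBpos i).ne'
    field_simp
  rw [h2]
  have h3 := mul_le_mul_of_nonneg_right h1 hApos.le
  rw [inv_mul_cancel₀ hApos.ne'] at h3
  calc σ ^ 2 / n * A = ε * (σ ^ 2 / ε / n * A) := by field_simp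
    _ ≤ ε * 1 := by gcongr
    _ = ε := mul_one ε

variable [IsProbabilityMeasure P] {f : Fin n → Pt d → ℝ} {g : Fin n → Pt d → Ξ → Pt d} {σ ε : ℝ}
  {B : Fin n → ℕ}

theorem batchGradient_moments (hn : 0 < n) (hS : IsSampling P D ξ)
    (hg : ∀ i, IsStochasticGradient (D i) (f i) σ (g i)) (hε : 0 < ε)
    (hB : BatchesSuffice (σ ^ 2 / ε) B) (k : ℕ) (x : Pt d) :
    ∃ e : Ω → Pt d, (∀ ω, batchGradient B g x (fun i j => ξ k i j ω) =
        gradient (meanObjective f) x + e ω) ∧ Integrable e P ∧ ∫ ω, e ω ∂P = 0 ∧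
      Integrable (fun ω => ‖e ω‖ ^ 2) P ∧ ∫ ω, ‖e ω‖ ^ 2 ∂P ≤ ε := by
  have hn' : (0 : ℝ) < n := by exact_mod_cast hn
  have hBpos : ∀ i, (0 : ℝ) < B i := fun i => by exact_mod_cast hB.1 i
  let W : Fin n → ℕ → Ω → Pt d := fun i j ω => g i x (ξ k i j ω) - gradient (f i) x
  let Z : (_ : Fin n) × ℕ → Ω → Pt d := fun q ω => (1 / ((n : ℝ) * B q.1)) • W q.1 q.2 ω
  let s : Finset ((_ : Fin n) × ℕ) := Finset.univ.sigma fun i => Finset.range (B i)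
  have hgx : ∀ i, Measurable (g i x) := fun i => (hg i).measurable.comp measurable_prodMk_left
  have hWint : ∀ i j, Integrable (W i j) P := by
    intro i j
    have h := (hg i).integrable x
    rw [← hS.law k i j] at h
    exact (h.comp_measurable (hS.measurable k i j)).sub (integrable_const _)
  have hWzero : ∀ i j, ∫ ω, W i j ω ∂P = 0 := by
    intro i j
    have h := (hg i).integrable x
    rw [← hS.law k i j] at h
    have h1 : ∫ ω, g i x (ξ k i j ω) ∂P = gradient (f i) x := by
      rw [← (hg i).unbiased x, ← hS.law k i j,
        integral_map (hS.measurable k i j).aemeasurable (hgx i).aestronglyMeasurable]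
    have h2 := integral_sub (h.comp_measurable (hS.measurable k i j))
      (integrable_const (μ := P) (gradient (f i) x))
    simp only [Function.comp_apply, integral_const, probReal_univ, one_smul, h1, sub_self] at h2
    exact h2
  have hWsq : ∀ i j, Integrable (fun ω => ‖W i j ω‖ ^ 2) P := by
    intro i j
    have h := (hg i).sq_integrable x
    rw [← hS.law k i j] at h
    exact h.comp_measurable (hS.measurable k i j)
  have hWvar : ∀ i j, ∫ ω, ‖W i j ω‖ ^ 2 ∂P ≤ σ ^ 2 := by
    intro i j
    refine le_trans (le_of_eq ?_) ((hg i).variance_le x)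
    rw [← hS.law k i j, integral_map (hS.measurable k i j).aemeasurable]
    exact ((((hgx i).sub_const _).norm).pow_const 2).aestronglyMeasurable
  have hZsq : ∀ q ω, ‖Z q ω‖ ^ 2 = (1 / ((n : ℝ) * B q.1)) ^ 2 * ‖W q.1 q.2 ω‖ ^ 2 := by
    intro q ω
    simp only [Z]
    rw [norm_smul, mul_pow, Real.norm_eq_abs, sq_abs]
  have hZint : ∀ q, Integrable (Z q) P := fun q =>
    (hWint q.1 q.2).smul (1 / ((n : ℝ) * B q.1))
  obtain ⟨h1, h2⟩ := integral_norm_sum_sq_eq (P := P) (s := s) (Z := Z)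
    (fun q _ => hZint q)
    (fun q _ => by simp only [hZsq]; exact (hWsq q.1 q.2).const_mul _)
    (fun q _ => by simp only [Z]; rw [integral_smul, hWzero, smul_zero])
    (fun q _ q' _ hne => by
      have hind : IndepFun (ξ k q.1 q.2) (ξ k q'.1 q'.2) P :=
        hS.indep.indepFun (i := (k, q.1, q.2)) (j := (k, q'.1, q'.2)) fun h => hne (by
          simp only [Prod.mk.injEq, true_and] at h
          exact Sigma.ext h.1 (heq_of_eq h.2))
      exact hind.comp (φ := fun z => (1 / ((n : ℝ) * B q.1)) • (g q.1 x z - gradient (f q.1) x))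
        (ψ := fun z => (1 / ((n : ℝ) * B q'.1)) • (g q'.1 x z - gradient (f q'.1) x))
        (by have := hgx q.1; fun_prop) (by have := hgx q'.1; fun_prop))
  refine ⟨fun ω => ∑ q ∈ s, Z q ω, fun ω => ?_, ?_, ?_, h1, ?_⟩
  · simp only [s]
    rw [gradient_meanObjective fun i => (hg i).differentiable, batchGradient, Finset.sum_sigma,
      Finset.smul_sum, Finset.smul_sum, ← Finset.sum_add_distrib]
    refine Finset.sum_congr rfl fun i _ => ?_
    simp only [Z, W]
    rw [← Finset.smul_sum, Finset.sum_sub_distrib, Finset.sum_const, Finset.card_range, smul_sub,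
      ← Nat.cast_smul_eq_nsmul ℝ, smul_smul, smul_smul]
    have := (hBpos i).ne'
    rw [show 1 / ((n : ℝ) * B i) * B i = 1 / n by field_simp,
      show 1 / (n : ℝ) * (1 / B i) = 1 / (n * B i) by field_simp]
    abel
  · exact integrable_finsetSum _ fun q _ => hZint q
  · rw [integral_finsetSum _ fun q _ => hZint q]
    refine Finset.sum_eq_zero fun q _ => ?_
    simp only [Z]
    rw [integral_smul, hWzero, smul_zero]
  · rw [h2]
    refine le_trans ?_ (sq_mul_sum_inv_le hε hn hB)
    rw [Finset.sum_sigma]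
    refine Finset.sum_le_sum fun i _ => ?_
    refine (Finset.sum_le_card_nsmul (Finset.range (B i)) _
      ((1 / ((n : ℝ) * B i)) ^ 2 * σ ^ 2) fun j _ => ?_).trans_eq
      (by rw [Finset.card_range, nsmul_eq_mul])
    simp only [hZsq]
    rw [integral_const_mul]
    exact mul_le_mul_of_nonneg_left (hWvar i j) (sq_nonneg _)

end Oracle

/-! ### Convergence of Leon SGD -/

section Convergence

variable {n d : ℕ} {Ω Ξ : Type*} [MeasurableSpace Ω] [MeasurableSpace Ξ] {P : Measure Ω}
  [IsProbabilityMeasure P] {D : Fin n → Measure Ξ} {ξ : ℕ → Fin n → ℕ → Ω → Ξ}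
  {f : Fin n → Pt d → ℝ} {g : Fin n → Pt d → Ξ → Pt d} {σ ε L fStar : ℝ} {B : Fin n → ℕ}

/-- Integrability of `f` along the iterates is not known in advance. Subtracting `fStar` makes all
terms nonnegative, so the recursion can run in `ℝ≥0∞`. -/
theorem lintegral_gradient_step_le (hn : 0 < n) (hL : 0 < L) (hf : IsSmooth L (meanObjective f))
    (hfStar : ∀ x, fStar ≤ meanObjective f x) (hS : IsSampling P D ξ)
    (hg : ∀ i, IsStochasticGradient (D i) (f i) σ (g i)) (hε : 0 < ε)
    (hB : BatchesSuffice (σ ^ 2 / ε) B) (k : ℕ) (x : Pt d) :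
    ∫⁻ ω, ENNReal.ofReal (meanObjective f
        (x - (1 / (2 * L)) • batchGradient B g x fun i j => ξ k i j ω) - fStar) ∂P +
      ENNReal.ofReal (3 / (8 * L) * ‖gradient (meanObjective f) x‖ ^ 2) ≤
    ENNReal.ofReal (meanObjective f x - fStar) + ENNReal.ofReal (ε / (8 * L)) := by
  set φ := meanObjective f
  obtain ⟨e, he, heint, hezero, hesq, hevar⟩ := batchGradient_moments hn hS hg hε hB k x
  let H : Ω → ℝ := fun ω =>
    φ x - fStar - 1 / (4 * L) * inner ℝ (gradient φ x) (e ω) + 1 / (8 * L) * ‖e ω‖ ^ 2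
  have hpt : ∀ ω, φ (x - (1 / (2 * L)) • batchGradient B g x fun i j => ξ k i j ω) - fStar +
      3 / (8 * L) * ‖gradient φ x‖ ^ 2 ≤ H ω := by
    intro ω
    have := hf.gradient_step_le hL x (e ω)
    rw [he ω]
    simp only [H]
    linarith
  have hinner : Integrable (fun ω => inner ℝ (gradient φ x) (e ω)) P := heint.const_inner _
  have hlin : Integrable (fun ω => φ x - fStar - 1 / (4 * L) * inner ℝ (gradient φ x) (e ω)) P :=
    (integrable_const _).sub (hinner.const_mul _)
  have hHint : Integrable H P := hlin.add (hesq.const_mul _)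
  have hHle : ∫ ω, H ω ∂P ≤ φ x - fStar + ε / (8 * L) := by
    have h1 : ∫ ω, H ω ∂P = φ x - fStar + 1 / (8 * L) * ∫ ω, ‖e ω‖ ^ 2 ∂P := by
      simp only [H]
      rw [integral_add hlin (hesq.const_mul _),
        integral_sub (integrable_const _) (hinner.const_mul _), integral_const_mul,
        integral_const_mul, integral_inner heint, hezero, inner_zero_right, integral_const,
        probReal_univ, one_smul]
      ring
    have h2 : 1 / (8 * L) * ∫ ω, ‖e ω‖ ^ 2 ∂P ≤ 1 / (8 * L) * ε := by gcongr
    rw [h1]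
    refine (add_le_add_right h2 _).trans_eq ?_
    ring
  calc _ = ∫⁻ ω, (ENNReal.ofReal (φ
        (x - (1 / (2 * L)) • batchGradient B g x fun i j => ξ k i j ω) - fStar) +
      ENNReal.ofReal (3 / (8 * L) * ‖gradient φ x‖ ^ 2)) ∂P := by
        rw [lintegral_add_right _ measurable_const, lintegral_const, measure_univ, mul_one]
    _ ≤ ∫⁻ ω, ENNReal.ofReal (H ω) ∂P := by
        refine lintegral_mono fun ω => ?_
        rw [← ENNReal.ofReal_add (sub_nonneg.mpr (hfStar _)) (by positivity)]
        exact ENNReal.ofReal_le_ofReal (hpt ω)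
    _ = ENNReal.ofReal (∫ ω, H ω ∂P) := by
        rw [ofReal_integral_eq_lintegral_ofReal hHint (Filter.Eventually.of_forall fun ω => ?_)]
        refine le_trans (add_nonneg (sub_nonneg.mpr (hfStar _)) ?_) (hpt ω)
        positivity
    _ ≤ ENNReal.ofReal (φ x - fStar + ε / (8 * L)) := ENNReal.ofReal_le_ofReal hHle
    _ = _ := ENNReal.ofReal_add (sub_nonneg.mpr (hfStar x)) (by positivity)

theorem lintegral_leonIterate_succ_le (hn : 0 < n) (hL : 0 < L)
    (hf : IsSmooth L (meanObjective f)) (hfStar : ∀ x, fStar ≤ meanObjective f x)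
    (hS : IsSampling P D ξ) (hg : ∀ i, IsStochasticGradient (D i) (f i) σ (g i)) (hε : 0 < ε)
    (hB : BatchesSuffice (σ ^ 2 / ε) B) (x₀ : Pt d) (k : ℕ) :
    ∫⁻ ω, ENNReal.ofReal (meanObjective f (leonIterate L B g x₀ ξ (k + 1) ω) - fStar) ∂P +
      ∫⁻ ω, ENNReal.ofReal
        (3 / (8 * L) * ‖gradient (meanObjective f) (leonIterate L B g x₀ ξ k ω)‖ ^ 2) ∂P ≤
    ∫⁻ ω, ENNReal.ofReal (meanObjective f (leonIterate L B g x₀ ξ k ω) - fStar) ∂P +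
      ENNReal.ofReal (ε / (8 * L)) := by
  have hgm : ∀ i, Measurable (Function.uncurry (g i)) := fun i => (hg i).measurable
  have hX : Measurable (leonIterate L B g x₀ ξ k) :=
    measurable_leonIterate hgm k fun k' _ i j => hS.measurable k' i j
  have hζ : Measurable fun ω i j => ξ k i j ω :=
    measurable_pi_lambda _ fun i => measurable_pi_lambda _ fun j => hS.measurable k i j
  have hgrad : Measurable (gradient (meanObjective f)) := (hf.continuous_gradient hL).measurable
  have hφ : Measurable (meanObjective f) := hf.1.continuous.measurable
  have hF : Measurable fun z : Pt d × (Fin n → ℕ → Ξ) => ENNReal.ofReal (meanObjective f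
      (z.1 - (1 / (2 * L)) • batchGradient B g z.1 z.2) - fStar) := by
    have := measurable_batchGradient (B := B) hgm
    fun_prop
  have hind := lintegral_prod_eq_of_indepFun hX hζ (hS.indepFun_leonIterate (L := L) (B := B)
    (x₀ := x₀) hgm k) hF
  simp only [leonIterate_succ]
  rw [hind, ← lintegral_add_right _ (by fun_prop)]
  refine (lintegral_mono fun ω => lintegral_gradient_step_le hn hL hf hfStar hS hg hε hB k _).trans ?_
  rw [lintegral_add_right _ measurable_const, lintegral_const, measure_univ, mul_one]

theorem lintegral_leonIterate_sum_le (hn : 0 < n) (hL : 0 < L)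
    (hf : IsSmooth L (meanObjective f)) (hfStar : ∀ x, fStar ≤ meanObjective f x)
    (hS : IsSampling P D ξ) (hg : ∀ i, IsStochasticGradient (D i) (f i) σ (g i)) (hε : 0 < ε)
    (hB : BatchesSuffice (σ ^ 2 / ε) B) (x₀ : Pt d) (k : ℕ) :
    ∫⁻ ω, ENNReal.ofReal (meanObjective f (leonIterate L B g x₀ ξ k ω) - fStar) ∂P +
      ∑ i ∈ Finset.range k, ∫⁻ ω, ENNReal.ofReal
        (3 / (8 * L) * ‖gradient (meanObjective f) (leonIterate L B g x₀ ξ i ω)‖ ^ 2) ∂P ≤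
    ENNReal.ofReal (meanObjective f x₀ - fStar + k * (ε / (8 * L))) := by
  induction k with
  | zero => simp [leonIterate]
  | succ k ih =>
    have h := lintegral_leonIterate_succ_le hn hL hf hfStar hS hg hε hB x₀ k
    have h0 := sub_nonneg.mpr (hfStar x₀)
    rw [Finset.sum_range_succ, add_comm (∑ i ∈ _, _), ← add_assoc]
    refine (add_le_add_left h _).trans ?_
    rw [add_right_comm]
    refine (add_le_add_left ih _).trans_eq ?_
    rw [← ENNReal.ofReal_add (by positivity) (by positivity)]
    congr 1
    push_cast
    ring

theorem leonIterate_convergence (hn : 0 < n) (hL : 0 < L)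
    (hf : IsSmooth L (meanObjective f)) (hfStar : ∀ x, fStar ≤ meanObjective f x)
    (hS : IsSampling P D ξ) (hg : ∀ i, IsStochasticGradient (D i) (f i) σ (g i)) (hε : 0 < ε)
    (hB : BatchesSuffice (σ ^ 2 / ε) B) (x₀ : Pt d) :
    (∀ k, Integrable (fun ω =>
      ‖gradient (meanObjective f) (leonIterate L B g x₀ ξ k ω)‖ ^ 2) P) ∧
    ∀ k, 3 / (8 * L) * ∑ i ∈ Finset.range k,
        ∫ ω, ‖gradient (meanObjective f) (leonIterate L B g x₀ ξ i ω)‖ ^ 2 ∂P ≤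
      meanObjective f x₀ - fStar + k * (ε / (8 * L)) := by
  have hgrad : Measurable (gradient (meanObjective f)) := (hf.continuous_gradient hL).measurable
  have hX : ∀ k, Measurable (leonIterate L B g x₀ ξ k) := fun k =>
    measurable_leonIterate (fun i => (hg i).measurable) k fun k' _ i j => hS.measurable k' i j
  have hsum : ∀ k, ∑ i ∈ Finset.range k, ∫⁻ ω, ENNReal.ofReal
        (3 / (8 * L) * ‖gradient (meanObjective f) (leonIterate L B g x₀ ξ i ω)‖ ^ 2) ∂P ≤
      ENNReal.ofReal (meanObjective f x₀ - fStar + k * (ε / (8 * L))) := fun k =>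
    le_add_self.trans (lintegral_leonIterate_sum_le hn hL hf hfStar hS hg hε hB x₀ k)
  have hmeas : ∀ k, AEStronglyMeasurable (fun ω => 3 / (8 * L) *
      ‖gradient (meanObjective f) (leonIterate L B g x₀ ξ k ω)‖ ^ 2) P := fun k => by
    have := hX k
    exact Measurable.aestronglyMeasurable (by fun_prop)
  have hnonneg : ∀ k, 0 ≤ᵐ[P] fun ω => 3 / (8 * L) *
      ‖gradient (meanObjective f) (leonIterate L B g x₀ ξ k ω)‖ ^ 2 := fun k =>
    Filter.Eventually.of_forall fun ω => by dsimp only [Pi.zero_apply]; positivity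
  have hint : ∀ k, Integrable (fun ω => 3 / (8 * L) *
      ‖gradient (meanObjective f) (leonIterate L B g x₀ ξ k ω)‖ ^ 2) P := by
    intro k
    refine ⟨hmeas k, ?_⟩
    rw [hasFiniteIntegral_iff_ofReal (hnonneg k)]
    -- The telescoped bound is finite, which gives integrability of each squared gradient norm a
    -- posteriori.
    refine lt_of_le_of_lt ?_ ((hsum (k + 1)).trans_lt ENNReal.ofReal_lt_top)
    exact Finset.single_le_sum (f := fun i => ∫⁻ ω, ENNReal.ofReal
        (3 / (8 * L) * ‖gradient (meanObjective f) (leonIterate L B g x₀ ξ i ω)‖ ^ 2) ∂P)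
      (fun _ _ => zero_le) (Finset.mem_range.mpr (Nat.lt_succ_self k))
  refine ⟨fun k => ?_, fun k => ?_⟩
  · refine ((hint k).const_mul (8 * L / 3)).congr (Filter.Eventually.of_forall fun ω => ?_)
    dsimp only
    field_simp
  · have h := hsum k
    have h0 := sub_nonneg.mpr (hfStar x₀)
    rw [Finset.sum_congr rfl fun i _ => (ofReal_integral_eq_lintegral_ofReal (hint i)
        (hnonneg i)).symm, ← ENNReal.ofReal_sum_of_nonneg fun i _ =>
        integral_nonneg_of_ae (hnonneg i), ENNReal.ofReal_le_ofReal_iff (by positivity)] at h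
    rw [Finset.mul_sum]
    simpa only [integral_const_mul] using h

end Convergence

/-! ### Total time and choice of constants -/

theorem leonClock_eq (τ T : ℝ) (k : ℕ) : leonClock τ T k = k * (τ + T) := by
  induction k with
  | zero => simp [leonClock]
  | succ k ih => rw [leonClock, ih]; push_cast; ring

theorem theorem3 :
    -- universal constants, and the number of iterations `K r = Θ(r)` as a function of `r = L Δ / ε`
    ∃ (c C : ℝ) (K : ℝ → ℕ), 0 < c ∧ 0 < C ∧
      (∀ r, 0 ≤ r → (K r : ℝ) ≤ C * r) ∧ (∀ r, 1 ≤ r → c * r ≤ (K r : ℝ)) ∧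
      ∀ (n d : ℕ) (G : BandwidthGraph n),
        -- the least edge weight of every Gomory–Hu tree is the global minimum cut value
        (∀ (T : SimpleGraph (Fin n)) (w : Sym2 (Fin n) → ℝ), G.IsGomoryHuTree T w →
          (⨅ e ∈ T.edgeSet, ENNReal.ofReal (w e)) = G.minCut) ∧
        -- there is an AllReduce with which Leon SGD runs as claimed
        ∃ (S : Set (Packet n)) (tComm : ℝ), IsAllReduce G d S tComm ∧
          ∀ (h : Fin n → ℝ) (σ ε : ℝ), (∀ i, 0 < h i) → 0 ≤ σ → 0 < ε →
            ∃ τ : ℝ, IsCollectTime h (σ ^ 2 / ε) τ ∧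
              ∀ (Ω Ξ : Type*) [MeasurableSpace Ω] [MeasurableSpace Ξ]
                (P : Measure Ω) [IsProbabilityMeasure P]
                (D : Fin n → Measure Ξ) [∀ i, IsProbabilityMeasure (D i)]
                (f : Fin n → Pt d → ℝ) (g : Fin n → Pt d → Ξ → Pt d)
                (ξ : ℕ → Fin n → ℕ → Ω → Ξ) (L fStar Δ : ℝ) (x₀ : Pt d),
                0 < L →
                IsSmooth L (meanObjective f) →
                (∀ x, fStar ≤ meanObjective f x) →
                Δ = meanObjective f x₀ - fStar →
                (∀ i, IsStochasticGradient (D i) (f i) σ (g i)) →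
                IsSampling P D ξ →
                -- after `K` iterations: a uniformly chosen one of the iterates `x⁰, …, x^K`, and
                -- also some fixed one of them, is an `ε`-stationary point
                (∀ k, k ≤ K (L * Δ / ε) →
                  Integrable (fun ω => ‖gradient (meanObjective f)
                    (leonIterate L (batchSize h τ) g x₀ ξ k ω)‖ ^ 2) P) ∧
                (1 / ((K (L * Δ / ε) : ℝ) + 1)) * ∑ k ∈ Finset.range (K (L * Δ / ε) + 1),
                  ∫ ω, ‖gradient (meanObjective f)
                    (leonIterate L (batchSize h τ) g x₀ ξ k ω)‖ ^ 2 ∂P ≤ ε ∧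
                (∃ k, k ≤ K (L * Δ / ε) ∧
                  IsEpsStationary P (meanObjective f) ε (leonIterate L (batchSize h τ) g x₀ ξ k)) ∧
                -- and these iterations are completed within the claimed time
                leonClock τ tComm (K (L * Δ / ε)) ≤
                  C * (iterationBound G d h σ ε * (L * Δ / ε)) := by
  -- With `K = ⌊4r⌋`, the bound `K + 1 > 4r` drives convergence and `K ≤ 4r` the running time. The
  -- constant is `48 = 4 · (4 + 8)`: iterations times collection plus AllReduce.
  refine ⟨1, 48, fun r => ⌊4 * r⌋₊, one_pos, by norm_num, fun r hr => ?_, fun r hr => ?_, ?_⟩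
  · exact (Nat.floor_le (by positivity)).trans (by linarith)
  · have := Nat.lt_floor_add_one (4 * r)
    linarith
  intro n d G
  refine ⟨fun T w hT => G.iInf_gomoryHu_weight_eq_minCut hT, ?_⟩
  have hn : 0 < n := by
    obtain ⟨i⟩ : Nonempty (Fin n) := G.connected.nonempty
    exact i.pos
  obtain ⟨S, hAll⟩ := G.exists_isAllReduce d
  refine ⟨S, _, hAll, fun h σ ε hh _ hε => ?_⟩
  obtain ⟨τ, hτ, hτle⟩ := exists_isCollectTime_le hn h hh (ρ := σ ^ 2 / ε) (by positivity)
  refine ⟨τ, hτ, ?_⟩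
  intro Ω Ξ _ _ P _ D _ f g ξ L fStar Δ x₀ hL hf hfStar hΔ hg hS
  obtain ⟨hint, hsum⟩ := leonIterate_convergence hn hL hf hfStar hS hg hε hτ.1.2 x₀
  set r := L * Δ / ε with hr
  have hΔ0 : 0 ≤ Δ := by rw [hΔ]; exact sub_nonneg.mpr (hfStar x₀)
  have hr0 : 0 ≤ r := by positivity
  have hK0 : (⌊4 * r⌋₊ : ℝ) ≤ 4 * r := Nat.floor_le (by positivity)
  have hK1 : 4 * r < ⌊4 * r⌋₊ + 1 := Nat.lt_floor_add_one _
  set K := ⌊4 * r⌋₊ with hK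
  have hsumK : ∑ k ∈ Finset.range (K + 1), ∫ ω, ‖gradient (meanObjective f)
      (leonIterate L (batchSize h τ) g x₀ ξ k ω)‖ ^ 2 ∂P ≤ (K + 1 : ℝ) * ε := by
    have h1 := hsum (K + 1)
    have h2 : 4 * (L * Δ) < (K + 1) * ε := by
      rw [hr, mul_div_assoc', div_lt_iff₀ hε] at hK1
      exact hK1
    rw [← hΔ, div_mul_eq_mul_div, div_le_iff₀ (by positivity)] at h1
    have h3 : (Δ + ((K + 1 : ℕ) : ℝ) * (ε / (8 * L))) * (8 * L) = 8 * (L * Δ) + (K + 1) * ε := by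
      push_cast
      field_simp
    rw [h3] at h1
    -- Here `3 Σ ≤ 8LΔ + (K + 1)ε`, and `8LΔ < 2(K + 1)ε` by the choice of `K`.
    linarith
  refine ⟨fun k _ => hint k, ?_, ?_, ?_⟩
  · rw [one_div, inv_mul_le_iff₀ (by positivity)]
    exact hsumK
  · obtain ⟨k, hk, hle⟩ := Finset.exists_le_of_sum_le (s := Finset.range (K + 1))
      (f := fun k => ∫ ω, ‖gradient (meanObjective f)
        (leonIterate L (batchSize h τ) g x₀ ξ k ω)‖ ^ 2 ∂P) (g := fun _ => ε) (by simp) (by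
          simpa using hsumK)
    exact ⟨k, Nat.lt_succ_iff.mp (Finset.mem_range.mp hk),
      measurable_leonIterate (fun i => (hg i).measurable) k fun k' _ i j => hS.measurable k' i j,
      hint k, hle⟩
  · rw [leonClock_eq]
    have h1 : τ ≤ 4 * iterationBound G d h σ ε := by
      refine hτle.trans ?_
      rw [div_div, mul_comm ε]
      exact mul_le_mul_of_nonneg_left (le_max_right _ _) (by norm_num)
    have h2 : 8 * ((d : ℝ≥0∞) / G.minCut).toReal ≤ 8 * iterationBound G d h σ ε :=
      mul_le_mul_of_nonneg_left (le_max_left _ _) (by norm_num)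
    have h3 : 0 ≤ iterationBound G d h σ ε := le_max_of_le_left ENNReal.toReal_nonneg
    have h4 : 0 ≤ τ + 8 * ((d : ℝ≥0∞) / G.minCut).toReal :=
      add_nonneg hτ.1.1 (by positivity)
    calc (K : ℝ) * (τ + 8 * ((d : ℝ≥0∞) / G.minCut).toReal)
        ≤ (4 * r) * (4 * iterationBound G d h σ ε + 8 * iterationBound G d h σ ε) := by gcongr
      _ = 48 * (iterationBound G d h σ ε * r) := by ring
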